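/- Consider a lottery contest with $n\ge 3$ homogeneous agents with cost $c>0$: at an output profile $x\in\mathbb R_{\ge 0}^n$ agent $i$ has utility $u_i(x)=\frac{x_i}{\sum_j x_j}-c\,x_i$ (the prize share is $\frac1n$ if $x=0$). A profile $x$ is an $\epsilon$-approximate equilibrium if $u_i(x)\ge(1-\epsilon)\,u_i(z,x_{-i})$ for every agent $i$ and every $z\ge 0$. The best response of agent $i$ is, with $Y=\sum_{j\ne i}x_j$: $a$ if $Y=0$; $\sqrt{Y/c}-Y$ if $0<Y\le 1/c$; $0$ if $Y>1/c$; here $a>0$ is a fixed constant with $ca<\frac14$. In the randomized best-response dynamics from $x_0\in\mathbb R_{\ge0}^n$, at each time $t=0,1,2,\dots$ one agent, equal to $i$ with probability $w_{t,i}(x_t)$, replaces its output by its best response to $x_t$, which gives $x_{t+1}$. The selection rule $w$ is called $(L,U)$-admissible, where $0<L\le U<\frac12$, if along every history of positive probability $w_{t,i}(x_t)\le U$ for all agents $i$ and $w_{t,i}(x_t)\ge L$ for all agents $i$ except the one who made the last move (if any). Put $$\gamma(x_0)=\min\big(A\cup B\cup\{ca\}\big),\quad A=\{c\,x_{0,i}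 : 0<c\,x_{0,i}<1\},\quad B=\Big\{\sqrt{(1-\sqrt y)/2} : y\in A\Big\}.$$ (Upper bound) There is an absolute constant $C>0$ such that for all $n\ge3$, $c$, $a$, $L$, $U$ as above, all initial profiles $x_0$, all $(L,U)$-admissible selection rules $w$, all $\epsilon,\delta\in(0,1)$ and every integer $$T\ge C\left(\frac{1}{1-2U}\log\log\frac1{\gamma(x_0)}+\frac1{L(1-2U)}\log\frac{n}{\epsilon\delta}+\frac1{(1-2U)^2}\log\frac1\delta\right),$$ the dynamics reaches an $\epsilon$-approximate equilibrium within its first $T$ moves with probability at least $1-\delta$. (Lower bound, in the worst case over initial profiles and selection rules) There is an absolute constant $\kappa>0$ such that for all $n\ge3$, $c$, $a$ as above, all $L,U$ with $0<L\le\frac1n\le U<\frac12$ and $L+(n-1)U\ge1$, and all $\gamma\in(0,ca]$, there are an initial profile $x_0$ with $\gamma(x_0)=\gamma$ and an $(L,U)$-admissible selection rule $w$ such that for all $\epsilon,\delta\in(0,1)$, with probability at least $1-\delta$, the number of moves until the dynamics first reaches an $\epsilon$-approximate equilibrium is at least $$\kappa\left(\Big(n+\frac1L\Big(1-\frac1{nU}\Big)\Big)\max\{0,\log(n\delta)\}+\log\log\frac1\epsilon+\log\log\frac1\gamma\right).$$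 -/

import Mathlib

open scoped ENNReal

noncomputable section

namespace LotteryContest

variable {n : ℕ}

/-- Utility of agent `i` at the profile `x` in the lottery contest with one unit prize and
linear cost `c * x i`: the prize is shared in proportion to the outputs, and equally if nobody
produces anything. -/
def utility (c : ℝ) (x : Fin n → ℝ) (i : Fin n) : ℝ :=
  (if ∑ j, x j = 0 then 1 / (n : ℝ) else x i / ∑ j, x j) - c * x i

/-- `x` is an `ε`-approximate pure-strategy Nash equilibrium: no agent `i` has an action `z ≥ 0`
with `u_i(x) < (1 - ε) * u_i(z, x_{-i})`. -/
def IsApproxEquilibrium (c ε : ℝ) (x : Fin n → ℝ) : Prop :=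
  ∀ i : Fin n, ∀ z : ℝ, 0 ≤ z →
    (1 - ε) * utility c (Function.update x i z) i ≤ utility c x i

/-- The total output of all agents except `i`. -/
def othersOutput (x : Fin n → ℝ) (i : Fin n) : ℝ :=
  ∑ j ∈ Finset.univ.erase i, x j

/-- The best response of agent `i`; by convention it is `a` when all others produce nothing
(where the utility has no maximizer). Outputs are nonnegative, so `othersOutput x i = 0` says
that all others produce nothing. -/
def bestResponse (c a : ℝ) (x : Fin n → ℝ) (i : Fin n) : ℝ :=
  if othersOutput x i = 0 then a
  else if othersOutput x i ≤ 1 / c then √(othersOutput x i / c) - othersOutput x i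
  else 0

/-- Agent `i` makes a best-response move. -/
def move (c a : ℝ) (x : Fin n → ℝ) (i : Fin n) : Fin n → ℝ :=
  Function.update x i (bestResponse c a x i)

/-- The profile reached from `x₀` after the moves recorded in a history. A history lists the
movers with the MOST RECENT mover first, so `i :: h` is the history `h` followed by a move
of `i`. -/
def profileAfter (c a : ℝ) (x₀ : Fin n → ℝ) : List (Fin n) → (Fin n → ℝ)
  | [] => x₀
  | i :: h => move c a (profileAfter c a x₀ h) i

/-- A randomized selection rule: `w t x` is the distribution of the agent who moves at time `t`
when the current profile is `x`, so `w t x i` is the probability that it is agent `i`. -/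
abbrev SelectionRule (n : ℕ) : Type := ℕ → (Fin n → ℝ) → PMF (Fin n)

/-- The law of the history of the first `T` moves. -/
def historyLaw (c a : ℝ) (w : SelectionRule n) (x₀ : Fin n → ℝ) : ℕ → PMF (List (Fin n))
  | 0 => PMF.pure []
  | T + 1 => (historyLaw c a w x₀ T).bind fun h =>
      (w T (profileAfter c a x₀ h)).map fun i => i :: h

/-- Along every history that occurs with positive probability, every agent is selected with
probability at most `U`, and every agent except the one who made the last move (there is none
at time `0`) is selected with probability at least `L`. -/
def IsAdmissible (c a L U : ℝ) (w : SelectionRule n) (x₀ : Fin n → ℝ) : Prop :=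
  ∀ T : ℕ, ∀ h ∈ (historyLaw c a w x₀ T).support, ∀ i : Fin n,
    (w T (profileAfter c a x₀ h) i).toReal ≤ U ∧
    (h.head? ≠ some i → L ≤ (w T (profileAfter c a x₀ h) i).toReal)

/-- At some moment of the history `h` (the start and the end included) the profile was an
`ε`-approximate equilibrium. The suffixes of `h` are the histories up to the earlier times. -/
def Reaches (c a ε : ℝ) (x₀ : Fin n → ℝ) (h : List (Fin n)) : Prop :=
  ∃ h' : List (Fin n), h' <:+ h ∧ IsApproxEquilibrium c ε (profileAfter c a x₀ h')

/-- The probability that the dynamics reaches an `ε`-approximate equilibrium within its first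
`T` moves. -/
def probReached (c a ε : ℝ) (w : SelectionRule n) (x₀ : Fin n → ℝ) (T : ℕ) : ℝ :=
  ((historyLaw c a w x₀ T).toOuterMeasure {h | Reaches c a ε x₀ h}).toReal

/-- The probability that the dynamics reaches no `ε`-approximate equilibrium within its first
`T` moves. -/
def probNotReached (c a ε : ℝ) (w : SelectionRule n) (x₀ : Fin n → ℝ) (T : ℕ) : ℝ :=
  ((historyLaw c a w x₀ T).toOuterMeasure {h | ¬ Reaches c a ε x₀ h}).toReal

/-- The initial outputs, in units in which the cost is `1`, that lie strictly between `0`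
and `1`. -/
def interiorOutputs (c : ℝ) (x₀ : Fin n → ℝ) : Set ℝ :=
  {y | (∃ i, y = c * x₀ i) ∧ 0 < y ∧ y < 1}

/-- `γ = min (A ∪ B ∪ {c a})` with `A = interiorOutputs` and `B = {√((1 - √y) / 2) | y ∈ A}`
(a finite nonempty set, so that the infimum is the minimum). -/
def gamma (c a : ℝ) (x₀ : Fin n → ℝ) : ℝ :=
  sInf (interiorOutputs c x₀ ∪ (fun y => √((1 - √y) / 2)) '' interiorOutputs c x₀ ∪ {c * a})

end LotteryContest

end

/-!
After multiplication of all outputs by `c` the cost is `1`. Write `s` for the total output and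
`Y` for the output of everybody but the mover. A best response to `0 < Y ≤ 1` takes `s` to `√Y`, one
to `Y ≥ 1` takes the mover to `0`, and a second move in a row by the same agent changes nothing.

**Upper bound.** The dynamics passes through four phases. In each phase a nonnegative function
contracts in expectation at every step, so that Markov's inequality bounds the probability that
the phase takes long (`expect_le_add_of_contract`).

* Until everybody has moved, the number of agents that have not moved contracts by `1 - L`
  (`sum_mover_unmoved_le`). Whatever the moves, the total output stays at least `γ`
  (`gamma_le_total`).
* While `s ≤ 1/2`, the last mover produces at least half of the total output, hence any change of
  the mover takes `s` to at least `√(s / 2)`: the logarithm of `2 s` halves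
  (`sum_mover_deficit_le`). Doubly logarithmic time suffices.
* From `s ≥ 9/20` the dynamics reaches the region `Tame 0`, where `s ≥ 11/20` and all outputs are
  at most `99/400`, and never leaves it. A step function of the profile, `rank`, contracts by
  `1 - L / 3` (`sum_mover_rank_le`).
* In this region every move minimizes the convex function
  `(s² - s) / 2 + ∑ i, (1 - 4 x i) ^ (3 / 2) / 12` in the coordinate of the mover. This function is
  strongly convex, and it is smooth in each coordinate, so its excess over the minimum, which is
  attained at the equilibrium, contracts by `1 - L / 11`, as in randomized coordinate descent
  (`sum_mover_excess_le`). The last mover, whose probability may be below `L`, has nothing to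
  improve. A small excess means an approximate equilibrium (`isApproxEquilibrium_of_excess_lt`).

**Lower bound.** At most two agents are active at the start, with output `g`, and the mover is drawn
independently from a fixed distribution. There are three obstacles to fast convergence.

* An idle agent is not at an approximate best response. As many initially idle agents as possible
  get a small probability to move, either `1/n` or `L`, and a coupon collector argument bounds
  the time until all of them have moved (`expect_failure_ge`, `coupon_pow_le`).
* One move decreases the largest distance of an output to the equilibrium at most by the factor
  `7 n`: if all outputs but the mover's were already very close, then the last mover, having
  responded to the mover's output, could not be (`abs_sub_lt_of_last`). An `ε`-approximate
  equilibrium requires a distance of at most `10 √ε`, and until all initially idle agents have moved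
  there is none, so `n` may be bounded by the number of moves
  (`not_isApproxEquilibrium_of_length_lt`).
* A move takes `s` to at most `√s`, so `s` stays tiny for about `log (log (1 / g))` moves. In a
  profile of tiny total output the last mover has nearly all of the prize, and everybody else could
  gain (`not_isApproxEquilibrium_of_small`).
-/

noncomputable section

namespace LotteryContest

/-! ### Iterated expectations along the tree of histories -/

section Expectation

variable {n : ℕ}

/-- The expected value of `V` after `K` further random moves from the history `h`, if at a
history `h'` the next mover is `i` with probability `p h' i`. -/
def expect (p : List (Fin n) → Fin n → ℝ) : ℕ → (List (Fin n) → ℝ) → List (Fin n) → ℝ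
  | 0, V, h => V h
  | K + 1, V, h => ∑ i, p h i * expect p K V (i :: h)

/-- `p` assigns a probability distribution of the next mover to each history. -/
structure IsMoverLaw (p : List (Fin n) → Fin n → ℝ) : Prop where
  nonneg : ∀ h i, 0 ≤ p h i
  sum_eq_one : ∀ h, ∑ i, p h i = 1

/-- A set of histories is closed for `p` if no move of positive probability leaves it. -/
def IsClosedUnder (p : List (Fin n) → Fin n → ℝ) (I : List (Fin n) → Prop) : Prop :=
  ∀ h i, I h → p h i ≠ 0 → I (i :: h)

variable {p : List (Fin n) → Fin n → ℝ}

lemma expect_add (K M : ℕ) (V : List (Fin n) → ℝ) (h : List (Fin n)) :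
    expect p (K + M) V h = expect p K (expect p M V) h := by
  induction K generalizing h with
  | zero => simp [expect]
  | succ K ih => simp only [Nat.succ_add, expect, ih]

lemma expect_const (hp : IsMoverLaw p) (K : ℕ) (d : ℝ) (h : List (Fin n)) :
    expect p K (fun _ => d) h = d := by
  induction K generalizing h with
  | zero => rfl
  | succ K ih => simp only [expect, ih, ← Finset.sum_mul, hp.sum_eq_one, one_mul]

lemma expect_add_fun (K : ℕ) (V W : List (Fin n) → ℝ) (h : List (Fin n)) :
    expect p K (fun h => V h + W h) h = expect p K V h + expect p K W h := by
  induction K generalizing h with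
  | zero => rfl
  | succ K ih => simp only [expect, ih, mul_add, Finset.sum_add_distrib]

lemma expect_mul_const (K : ℕ) (V : List (Fin n) → ℝ) (r : ℝ) (h : List (Fin n)) :
    expect p K (fun h => V h * r) h = expect p K V h * r := by
  induction K generalizing h with
  | zero => rfl
  | succ K ih => simp only [expect, ih, ← mul_assoc, ← Finset.sum_mul]

/-- One-step averages are monotone in the values at the successors of positive probability. -/
lemma sum_mover_mono (hp : IsMoverLaw p) {h : List (Fin n)} {f g : Fin n → ℝ}
    (hfg : ∀ i, p h i ≠ 0 → f i ≤ g i) : ∑ i, p h i * f i ≤ ∑ i, p h i * g i := by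
  refine Finset.sum_le_sum fun i _ => ?_
  by_cases hi : p h i = 0
  · simp [hi]
  · exact mul_le_mul_of_nonneg_left (hfg i hi) (hp.nonneg h i)

lemma expect_mono (hp : IsMoverLaw p) {I : List (Fin n) → Prop} (hI : IsClosedUnder p I)
    {V W : List (Fin n) → ℝ} (hVW : ∀ h, I h → V h ≤ W h) (K : ℕ) {h : List (Fin n)} (hh : I h) :
    expect p K V h ≤ expect p K W h := by
  induction K generalizing h with
  | zero => exact hVW h hh
  | succ K ih => exact sum_mover_mono hp fun i hi => ih (hI h i hh hi)

/-- A function that contracts by the factor `ρ` in expectation at every step contracts by `ρ ^ K`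
in `K` steps. -/
lemma expect_le_pow (hp : IsMoverLaw p) {I : List (Fin n) → Prop} (hI : IsClosedUnder p I)
    {V : List (Fin n) → ℝ} {ρ : ℝ} (hρ : 0 ≤ ρ)
    (hV : ∀ h, I h → ∑ i, p h i * V (i :: h) ≤ ρ * V h) (K : ℕ) {h : List (Fin n)} (hh : I h) :
    expect p K V h ≤ ρ ^ K * V h := by
  induction K generalizing h with
  | zero => simp [expect]
  | succ K ih =>
    calc expect p (K + 1) V h ≤ ∑ i, p h i * (ρ ^ K * V (i :: h)) :=
          sum_mover_mono hp fun i hi => ih (hI h i hh hi)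
      _ = ρ ^ K * ∑ i, p h i * V (i :: h) := by
          rw [Finset.mul_sum]; exact Finset.sum_congr rfl fun i _ => by ring
      _ ≤ ρ ^ K * (ρ * V h) := mul_le_mul_of_nonneg_left (hV h hh) (by positivity)
      _ = ρ ^ (K + 1) * V h := by ring

/-- Markov's inequality for one phase: if `V` contracts in expectation and the failure
probability `F` is at most `d` as soon as `V < v`, then starting the phase `K` moves earlier
adds at most `ρ ^ K * V h / v`. -/
lemma expect_le_add_of_contract (hp : IsMoverLaw p) {I : List (Fin n) → Prop}
    (hI : IsClosedUnder p I) {V F : List (Fin n) → ℝ} {ρ v d : ℝ} (hρ : 0 ≤ ρ) (hv : 0 < v)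
    (hd : 0 ≤ d) (hV0 : ∀ h, I h → 0 ≤ V h)
    (hV : ∀ h, I h → ∑ i, p h i * V (i :: h) ≤ ρ * V h)
    (hF1 : ∀ h, I h → F h ≤ 1) (hF : ∀ h, I h → V h < v → F h ≤ d) (K : ℕ)
    {h : List (Fin n)} (hh : I h) :
    expect p K F h ≤ d + ρ ^ K * V h / v := by
  have h1 : ∀ h, I h → F h ≤ d + V h * (1 / v) := by
    intro h hh
    rcases lt_or_ge (V h) v with hlt | hge
    · have := hF h hh hlt
      have h2 : 0 ≤ V h * (1 / v) := mul_nonneg (hV0 h hh) (by positivity)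
      linarith
    · have h2 : 1 ≤ V h * (1 / v) := by
        rw [mul_one_div, le_div_iff₀ hv]; linarith
      have := hF1 h hh
      linarith
  calc expect p K F h ≤ expect p K (fun h => d + V h * (1 / v)) h := expect_mono hp hI h1 K hh
    _ = d + expect p K V h * (1 / v) := by
        rw [expect_add_fun, expect_const hp, expect_mul_const]
    _ ≤ d + ρ ^ K * V h * (1 / v) := by
        gcongr
        exact expect_le_pow hp hI hρ hV K hh
    _ = d + ρ ^ K * V h / v := by ring

lemma expect_le_one (hp : IsMoverLaw p) {V : List (Fin n) → ℝ} (hV : ∀ h, V h ≤ 1) (K : ℕ)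
    (h : List (Fin n)) : expect p K V h ≤ 1 := by
  have h1 := expect_mono (V := V) (W := fun _ => 1) hp (I := fun _ => True)
    (fun _ _ _ _ => trivial) (fun h _ => hV h) K (h := h) trivial
  rwa [expect_const hp] at h1

/-- If `A i` improves on `V` by at least `1` for all `i` in a set `S` of movers, each of probability
at least `L`, and never exceeds `V`, then the mean of `A` is at most `V - L * #S`. -/
lemma sum_mover_le_sub (hp : IsMoverLaw p) {h : List (Fin n)} {A : Fin n → ℝ} {V L : ℝ}
    (S : Finset (Fin n)) (hS : ∀ i ∈ S, L ≤ p h i) (hA : ∀ i, p h i ≠ 0 → A i ≤ V)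
    (hAS : ∀ i ∈ S, A i ≤ V - 1) :
    ∑ i, p h i * A i ≤ V - L * S.card := by
  classical
  have h1 : ∑ i, p h i * A i ≤ ∑ i, p h i * (V - if i ∈ S then 1 else 0) := by
    refine sum_mover_mono hp fun i hi => ?_
    split_ifs with hiS
    · exact hAS i hiS
    · simpa using hA i hi
  have h2 : ∑ i, p h i * (V - if i ∈ S then (1 : ℝ) else 0) = V - ∑ i ∈ S, p h i := by
    simp only [mul_sub, Finset.sum_sub_distrib, ← Finset.sum_mul, hp.sum_eq_one, one_mul,
      mul_ite, mul_one, mul_zero, Finset.sum_ite_mem, Finset.univ_inter]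
  have h3 : L * S.card ≤ ∑ i ∈ S, p h i := by
    have := Finset.card_nsmul_le_sum S (p h) L hS
    rwa [nsmul_eq_mul, mul_comm] at this
  linarith

end Expectation

section Law

variable {n : ℕ} (c a : ℝ) (w : SelectionRule n) (x₀ : Fin n → ℝ)

/-- The probability that the selection rule lets `i` move after the history `h`. -/
def moverProb (h : List (Fin n)) (i : Fin n) : ℝ :=
  (w h.length (profileAfter c a x₀ h) i).toReal

/-- The history `h` occurs with positive probability. -/
def IsPossible (h : List (Fin n)) : Prop :=
  h ∈ (historyLaw c a w x₀ h.length).support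

lemma isMoverLaw_moverProb : IsMoverLaw (moverProb c a w x₀) where
  nonneg _ _ := ENNReal.toReal_nonneg
  sum_eq_one h := by
    unfold moverProb
    rw [← ENNReal.toReal_sum fun i _ => PMF.apply_ne_top _ i]
    have := PMF.tsum_coe (w h.length (profileAfter c a x₀ h))
    rw [tsum_fintype] at this
    rw [this, ENNReal.toReal_one]

lemma length_of_mem_support {T : ℕ} {h : List (Fin n)}
    (hh : h ∈ (historyLaw c a w x₀ T).support) : h.length = T := by
  induction T generalizing h with
  | zero => simp [historyLaw] at hh; simp [hh]
  | succ T ih =>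
    rw [historyLaw, PMF.mem_support_bind_iff] at hh
    obtain ⟨h', hh', hm⟩ := hh
    rw [PMF.mem_support_map_iff] at hm
    obtain ⟨i, -, rfl⟩ := hm
    simp [ih hh']

lemma isPossible_nil : IsPossible c a w x₀ [] := by
  simp [IsPossible, historyLaw]

lemma isClosedUnder_isPossible :
    IsClosedUnder (moverProb c a w x₀) (IsPossible c a w x₀) := by
  intro h i hh hi
  unfold IsPossible
  rw [List.length_cons, historyLaw, PMF.mem_support_bind_iff]
  refine ⟨h, hh, ?_⟩
  rw [PMF.mem_support_map_iff]
  refine ⟨i, ?_, rfl⟩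
  rw [PMF.mem_support_iff]
  intro h0
  exact hi (by simp [moverProb, h0])

/-- The law of the history after `K` further moves from the history `h`. -/
def futureLaw : ℕ → List (Fin n) → PMF (List (Fin n))
  | 0, h => PMF.pure h
  | K + 1, h => (w h.length (profileAfter c a x₀ h)).bind fun i => futureLaw K (i :: h)

lemma historyLaw_add (K T : ℕ) :
    historyLaw c a w x₀ (T + K) = (historyLaw c a w x₀ T).bind (futureLaw c a w x₀ K) := by
  induction K generalizing T with
  | zero => exact (PMF.bind_pure _).symm
  | succ K ih =>
    have h1 : T + (K + 1) = (T + 1) + K := by ring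
    rw [h1, ih, historyLaw, PMF.bind_bind]
    ext b
    simp only [PMF.bind_apply]
    refine tsum_congr fun h => ?_
    by_cases h0 : (historyLaw c a w x₀ T) h = 0
    · simp [h0]
    · have hl : h.length = T := length_of_mem_support c a w x₀ ((PMF.mem_support_iff _ _).2 h0)
      rw [← PMF.bind_apply, PMF.bind_map, futureLaw, hl]
      rfl

open Classical in
lemma toReal_futureLaw (S : Set (List (Fin n))) (K : ℕ) (h : List (Fin n)) :
    ((futureLaw c a w x₀ K h).toOuterMeasure S).toReal =
      expect (moverProb c a w x₀) K (fun h => if h ∈ S then 1 else 0) h := by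
  induction K generalizing h with
  | zero =>
    rw [futureLaw, PMF.toOuterMeasure_pure_apply, expect]
    split_ifs <;> simp
  | succ K ih =>
    rw [futureLaw, PMF.toOuterMeasure_bind_apply, expect, tsum_fintype, ENNReal.toReal_sum]
    · refine Finset.sum_congr rfl fun i _ => ?_
      rw [ENNReal.toReal_mul, ih, moverProb]
    · intro i _
      refine ENNReal.mul_ne_top (PMF.apply_ne_top _ _) (ne_top_of_le_ne_top ENNReal.one_ne_top ?_)
      have := ((futureLaw c a w x₀ K (i :: h)).toOuterMeasure_apply_eq_one_iff Set.univ).2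
        (Set.subset_univ _)
      exact this ▸ MeasureTheory.measure_mono (Set.subset_univ S)

open Classical in
lemma toReal_historyLaw (S : Set (List (Fin n))) (T : ℕ) :
    ((historyLaw c a w x₀ T).toOuterMeasure S).toReal =
      expect (moverProb c a w x₀) T (fun h => if h ∈ S then 1 else 0) [] := by
  rw [← toReal_futureLaw]
  have := historyLaw_add c a w x₀ T 0
  rw [zero_add, historyLaw, PMF.pure_bind] at this
  rw [this]

end Law

/-! ### Normalization of the cost and single moves -/

section Scaling

variable {n : ℕ} {c a : ℝ}

lemma othersOutput_eq_sum_sub (x : Fin n → ℝ) (i : Fin n) :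
    othersOutput x i = ∑ j, x j - x i := by
  rw [othersOutput, ← Finset.add_sum_erase _ _ (Finset.mem_univ i)]; ring

lemma othersOutput_smul (x : Fin n → ℝ) (i : Fin n) :
    othersOutput (fun j => c * x j) i = c * othersOutput x i := by
  simp only [othersOutput, Finset.mul_sum]

lemma bestResponse_smul (hc : 0 < c) (x : Fin n → ℝ) (i : Fin n) :
    bestResponse 1 (c * a) (fun j => c * x j) i = c * bestResponse c a x i := by
  have h1 : √(c * othersOutput x i) = c * √(othersOutput x i / c) := by
    have : c * othersOutput x i = c ^ 2 * (othersOutput x i / c) := by field_simp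
    rw [this, Real.sqrt_mul (by positivity), Real.sqrt_sq hc.le]
  have h2 : c * othersOutput x i ≤ 1 ↔ othersOutput x i ≤ 1 / c := by
    rw [le_div_iff₀ hc, mul_comm]
  have h3 : c * othersOutput x i = 0 ↔ othersOutput x i = 0 := by simp [hc.ne']
  simp only [bestResponse, othersOutput_smul, div_one, h2, h3, h1]
  split_ifs <;> ring

lemma profileAfter_smul (hc : 0 < c) (x₀ : Fin n → ℝ) (h : List (Fin n)) :
    profileAfter 1 (c * a) (fun j => c * x₀ j) h = fun j => c * profileAfter c a x₀ h j := by
  induction h with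
  | nil => rfl
  | cons i h ih =>
    simp only [profileAfter, move]
    rw [ih, bestResponse_smul hc]
    ext j
    by_cases hj : j = i
    · subst hj; simp
    · simp [hj]

lemma utility_smul (hc : 0 < c) (x : Fin n → ℝ) (i : Fin n) :
    utility 1 (fun j => c * x j) i = utility c x i := by
  have h3 : c * ∑ j, x j = 0 ↔ ∑ j, x j = 0 := by simp [hc.ne']
  simp only [utility, ← Finset.mul_sum, h3, mul_div_mul_left _ _ hc.ne', one_mul]

lemma isApproxEquilibrium_smul (hc : 0 < c) {ε : ℝ} (x : Fin n → ℝ) :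
    IsApproxEquilibrium 1 ε (fun j => c * x j) ↔ IsApproxEquilibrium c ε x := by
  have h1 : ∀ i z, (fun j => c * Function.update x i z j) =
      Function.update (fun j => c * x j) i (c * z) := by
    intro i z; ext j
    by_cases hj : j = i
    · subst hj; simp
    · simp [hj]
  constructor
  · intro H i z hz
    have := H i (c * z) (by positivity)
    rwa [← h1, utility_smul hc, utility_smul hc] at this
  · intro H i z hz
    have := H i (z / c) (by positivity)
    rwa [← utility_smul hc, ← utility_smul hc x, h1, mul_div_cancel₀ _ hc.ne'] at this

lemma reaches_smul (hc : 0 < c) {ε : ℝ} (x₀ : Fin n → ℝ) (h : List (Fin n)) :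
    Reaches 1 (c * a) ε (fun j => c * x₀ j) h ↔ Reaches c a ε x₀ h := by
  simp only [Reaches, profileAfter_smul hc, isApproxEquilibrium_smul hc]

lemma gamma_smul (x₀ : Fin n → ℝ) :
    gamma 1 (c * a) (fun j => c * x₀ j) = gamma c a x₀ := by
  simp only [gamma, interiorOutputs, one_mul]

end Scaling

section Moves

variable {n : ℕ} {α : ℝ}

/-- The best response to a total output `Y` of the others at unit cost. -/
def br (α Y : ℝ) : ℝ := if Y = 0 then α else if Y ≤ 1 then √Y - Y else 0

lemma bestResponse_one (x : Fin n → ℝ) (i : Fin n) :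
    bestResponse 1 α x i = br α (∑ j, x j - x i) := by
  rw [bestResponse, othersOutput_eq_sum_sub, br]; simp

lemma br_of_le_one {Y : ℝ} (h0 : 0 < Y) (h1 : Y ≤ 1) : br α Y = √Y - Y := by
  rw [br, if_neg h0.ne', if_pos h1]

lemma br_of_one_le {Y : ℝ} (h1 : 1 ≤ Y) : br α Y = 0 := by
  rcases h1.eq_or_lt with rfl | h
  · simp [br]
  · rw [br, if_neg (by linarith), if_neg (by linarith)]

lemma br_zero : br α 0 = α := by simp [br]

/-- The total output after a best response to the output `Y > 0` of the others. -/
lemma br_add_of_le_one {Y : ℝ} (h0 : 0 < Y) (h1 : Y ≤ 1) : Y + br α Y = √Y := by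
  rw [br_of_le_one h0 h1]; ring

lemma br_nonneg (hα : 0 ≤ α) {Y : ℝ} (hY : 0 ≤ Y) : 0 ≤ br α Y := by
  unfold br
  split_ifs with h0 h1
  · exact hα
  · have : Y ≤ √Y := Real.le_sqrt_of_sq_le (by nlinarith)
    linarith
  · exact le_rfl

lemma br_le_quarter (hα : α ≤ 1 / 4) {Y : ℝ} (hY : 0 ≤ Y) : br α Y ≤ 1 / 4 := by
  unfold br
  split_ifs with h0 h1
  · exact hα
  · nlinarith [Real.sq_sqrt hY, sq_nonneg (√Y - 1 / 2)]
  · norm_num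

/-- A lower bound `σ² ≤ Y` on the output of the others gives a total output of at least `σ`. -/
lemma le_br_add {Y σ : ℝ} (hσ0 : 0 < σ) (hσ : σ ≤ 1) (hY : σ ^ 2 ≤ Y) : σ ≤ Y + br α Y := by
  have hY0 : 0 < Y := lt_of_lt_of_le (by positivity) hY
  rcases le_total Y 1 with h1 | h1
  · rw [br_add_of_le_one hY0 h1]; exact Real.le_sqrt_of_sq_le hY
  · rw [br_of_one_le h1]; linarith

lemma move_one_same (x : Fin n → ℝ) (i : Fin n) : move 1 α x i i = br α (∑ j, x j - x i) := by
  simp [move, bestResponse_one]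

lemma move_of_ne (x : Fin n → ℝ) {i j : Fin n} (hj : j ≠ i) : move 1 α x i j = x j := by
  simp [move, hj]

lemma sum_move (x : Fin n → ℝ) (i : Fin n) :
    ∑ j, move 1 α x i j = (∑ j, x j - x i) + br α (∑ j, x j - x i) := by
  have h1 := Finset.add_sum_erase Finset.univ (move 1 α x i) (Finset.mem_univ i)
  have h2 := Finset.add_sum_erase Finset.univ x (Finset.mem_univ i)
  have h3 : ∑ j ∈ Finset.univ.erase i, move 1 α x i j = ∑ j ∈ Finset.univ.erase i, x j :=
    Finset.sum_congr rfl fun j hj => move_of_ne x (Finset.ne_of_mem_erase hj)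
  rw [move_one_same] at h1
  linarith

/-- The other agents' output is not affected by an agent's own move. -/
lemma sum_move_sub (x : Fin n → ℝ) (i : Fin n) :
    ∑ j, move 1 α x i j - move 1 α x i i = ∑ j, x j - x i := by
  rw [sum_move, move_one_same]; ring

/-- Two moves in a row by the same agent amount to one. -/
lemma move_move (x : Fin n → ℝ) (i : Fin n) : move 1 α (move 1 α x i) i = move 1 α x i := by
  ext j
  by_cases hj : j = i
  · subst hj
    rw [move_one_same, sum_move_sub, move_one_same]
  · rw [move_of_ne _ hj]

lemma sum_sub_nonneg {x : Fin n → ℝ} (hx : ∀ i, 0 ≤ x i) (i : Fin n) : 0 ≤ ∑ j, x j - x i := by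
  have := Finset.single_le_sum (fun j _ => hx j) (Finset.mem_univ i)
  linarith

lemma add_le_sum {x : Fin n → ℝ} (hx : ∀ i, 0 ≤ x i) {i j : Fin n} (hij : i ≠ j) :
    x i + x j ≤ ∑ k, x k := by
  rw [← Finset.sum_pair hij]
  exact Finset.sum_le_sum_of_subset_of_nonneg (Finset.subset_univ _) fun k _ _ => hx k

lemma move_nonneg (hα : 0 ≤ α) {x : Fin n → ℝ} (hx : ∀ i, 0 ≤ x i) (i j : Fin n) :
    0 ≤ move 1 α x i j := by
  by_cases hj : j = i
  · subst hj; rw [move_one_same]; exact br_nonneg hα (sum_sub_nonneg hx _)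
  · rw [move_of_ne _ hj]; exact hx j

lemma profileAfter_nonneg (hα : 0 ≤ α) {x₀ : Fin n → ℝ} (hx : ∀ i, 0 ≤ x₀ i) (h : List (Fin n))
    (i : Fin n) : 0 ≤ profileAfter 1 α x₀ h i := by
  induction h generalizing i with
  | nil => exact hx i
  | cons j h ih => exact move_nonneg hα ih j i

lemma profileAfter_of_notMem {x₀ : Fin n → ℝ} {h : List (Fin n)} {i : Fin n} (hi : i ∉ h) :
    profileAfter 1 α x₀ h i = x₀ i := by
  induction h with
  | nil => rfl
  | cons j h ih =>
    rw [List.mem_cons, not_or] at hi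
    rw [profileAfter, move_of_ne _ hi.1, ih hi.2]

lemma profileAfter_le_quarter (hα : 0 ≤ α) (hα' : α ≤ 1 / 4) {x₀ : Fin n → ℝ}
    (hx : ∀ i, 0 ≤ x₀ i) {h : List (Fin n)} {i : Fin n} (hi : i ∈ h) :
    profileAfter 1 α x₀ h i ≤ 1 / 4 := by
  induction h with
  | nil => simp at hi
  | cons j h ih =>
    rw [profileAfter]
    by_cases hj : i = j
    · subst hj
      rw [move_one_same]
      exact br_le_quarter hα' (sum_sub_nonneg (profileAfter_nonneg hα hx h) _)
    · rw [move_of_ne _ hj]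
      exact ih ((List.mem_cons.1 hi).resolve_left hj)

/-- The last mover's output is a best response to the current outputs of the others. -/
lemma profileAfter_cons_same (x₀ : Fin n → ℝ) (i : Fin n) (h : List (Fin n)) :
    profileAfter 1 α x₀ (i :: h) i =
      br α (∑ j, profileAfter 1 α x₀ (i :: h) j - profileAfter 1 α x₀ (i :: h) i) := by
  simp only [profileAfter]
  rw [sum_move_sub, move_one_same]

lemma profileAfter_cons_cons (x₀ : Fin n → ℝ) (i : Fin n) (h : List (Fin n)) :
    profileAfter 1 α x₀ (i :: i :: h) = profileAfter 1 α x₀ (i :: h) := by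
  simp only [profileAfter, move_move]

end Moves

section Utility

variable {n : ℕ}

/-- At unit cost and positive output of the others, the utility falls short of its maximal
value `(1 - √Y)²` by `(s - √Y)² / s`, where `s` is the total output. -/
lemma utility_eq {x : Fin n → ℝ} {i : Fin n} (hx : 0 ≤ x i) (hY : 0 < ∑ j, x j - x i) :
    utility 1 x i = (1 - √(∑ j, x j - x i)) ^ 2 -
      (∑ j, x j - √(∑ j, x j - x i)) ^ 2 / ∑ j, x j := by
  have hs : 0 < ∑ j, x j := by linarith
  have h1 := Real.sq_sqrt hY.le
  rw [utility, if_neg hs.ne']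
  set s := ∑ j, x j
  set r := √(s - x i)
  have h2 : x i = s - r ^ 2 := by linarith
  rw [h2]
  field_simp
  ring

lemma sum_update (x : Fin n → ℝ) (i : Fin n) (z : ℝ) :
    ∑ j, Function.update x i z j = (∑ j, x j - x i) + z := by
  have h1 := Finset.add_sum_erase Finset.univ (Function.update x i z) (Finset.mem_univ i)
  have h2 := Finset.add_sum_erase Finset.univ x (Finset.mem_univ i)
  have h3 : ∑ j ∈ Finset.univ.erase i, Function.update x i z j = ∑ j ∈ Finset.univ.erase i, x j :=
    Finset.sum_congr rfl fun j hj => Function.update_of_ne (Finset.ne_of_mem_erase hj) _ _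
  rw [Function.update_self] at h1
  linarith

lemma utility_update_eq (x : Fin n → ℝ) {i : Fin n} {z : ℝ} (hz : 0 ≤ z)
    (hY : 0 < ∑ j, x j - x i) :
    utility 1 (Function.update x i z) i = (1 - √(∑ j, x j - x i)) ^ 2 -
      ((∑ j, x j - x i) + z - √(∑ j, x j - x i)) ^ 2 / ((∑ j, x j - x i) + z) := by
  have h0 : ∑ j, Function.update x i z j - Function.update x i z i = ∑ j, x j - x i := by
    rw [sum_update, Function.update_self]; ring
  rw [utility_eq (by simpa using hz) (by rw [h0]; exact hY), h0, sum_update]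

/-- A profile is an approximate equilibrium if every agent's utility gap is an `ε`-fraction of
the maximal utility. -/
lemma isApproxEquilibrium_of_gap {x : Fin n → ℝ} {ε : ℝ} (hε : ε ≤ 1) (hx : ∀ i, 0 ≤ x i)
    (hY : ∀ i, 0 < ∑ j, x j - x i)
    (hgap : ∀ i, (∑ j, x j - √(∑ j, x j - x i)) ^ 2 / ∑ j, x j ≤
      ε * (1 - √(∑ j, x j - x i)) ^ 2) : IsApproxEquilibrium 1 ε x := by
  intro i z hz
  rw [utility_update_eq x hz (hY i), utility_eq (hx i) (hY i)]
  have h1 := hgap i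
  have h2 : 0 ≤ ((∑ j, x j - x i) + z - √(∑ j, x j - x i)) ^ 2 / ((∑ j, x j - x i) + z) :=
    div_nonneg (sq_nonneg _) (by linarith [hY i])
  nlinarith

/-- At an approximate equilibrium every agent gets nearly the utility `(1 - √Y)²` of a best
response. -/
lemma IsApproxEquilibrium.le_utility {x : Fin n → ℝ} {ε : ℝ} (H : IsApproxEquilibrium 1 ε x)
    {i : Fin n} (hY : 0 < ∑ j, x j - x i) (hY1 : ∑ j, x j - x i ≤ 1) :
    (1 - ε) * (1 - √(∑ j, x j - x i)) ^ 2 ≤ utility 1 x i := by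
  have h1 : ∑ j, x j - x i ≤ √(∑ j, x j - x i) := Real.le_sqrt_of_sq_le (by nlinarith)
  have h2 := H i (√(∑ j, x j - x i) - (∑ j, x j - x i)) (by linarith)
  rw [utility_update_eq x (by linarith) hY] at h2
  simpa using h2

lemma IsApproxEquilibrium.gap_le {x : Fin n → ℝ} {ε : ℝ} (H : IsApproxEquilibrium 1 ε x)
    {i : Fin n} (hx : 0 ≤ x i) (hY : 0 < ∑ j, x j - x i) (hY1 : ∑ j, x j - x i ≤ 1) :
    (∑ j, x j - √(∑ j, x j - x i)) ^ 2 / ∑ j, x j ≤ ε * (1 - √(∑ j, x j - x i)) ^ 2 := by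
  have := H.le_utility hY hY1
  rw [utility_eq hx hY] at this
  linarith

end Utility

/-! ### A lower bound for the total output -/

section Gamma

variable {n : ℕ} {c a : ℝ} {x₀ : Fin n → ℝ}

lemma interiorOutputs_finite : (interiorOutputs c x₀).Finite :=
  (Set.finite_range fun i => c * x₀ i).subset fun _ hy => by
    obtain ⟨⟨i, hi⟩, -⟩ := hy; exact ⟨i, hi.symm⟩

lemma gammaSet_finite : (interiorOutputs c x₀ ∪
    (fun y => √((1 - √y) / 2)) '' interiorOutputs c x₀ ∪ {c * a}).Finite :=
  (interiorOutputs_finite.union (interiorOutputs_finite.image _)).union (Set.finite_singleton _)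

lemma gamma_pos (ha : 0 < c * a) : 0 < gamma c a x₀ := by
  have hmem := Set.Nonempty.csInf_mem (s := interiorOutputs c x₀ ∪
    (fun y => √((1 - √y) / 2)) '' interiorOutputs c x₀ ∪ {c * a}) ⟨c * a, by simp⟩ gammaSet_finite
  change gamma c a x₀ ∈ _ at hmem
  rcases hmem with (h | ⟨y, ⟨-, hy0, hy1⟩, hy⟩) | h
  · exact h.2.1
  · simp only [] at hy
    rw [← hy]
    have : √y < 1 := (Real.sqrt_lt' one_pos).2 (by simpa using hy1)
    exact Real.sqrt_pos.2 (by linarith)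
  · rw [Set.mem_singleton_iff] at h; rw [h]; exact ha

lemma gamma_le : gamma c a x₀ ≤ c * a :=
  csInf_le gammaSet_finite.bddBelow (by simp)

lemma gamma_le_of_interior {i : Fin n} (h0 : 0 < c * x₀ i) (h1 : c * x₀ i < 1) :
    gamma c a x₀ ≤ c * x₀ i :=
  csInf_le gammaSet_finite.bddBelow (Or.inl (Or.inl ⟨⟨i, rfl⟩, h0, h1⟩))

lemma gamma_le_sqrt_of_interior {i : Fin n} (h0 : 0 < c * x₀ i) (h1 : c * x₀ i < 1) :
    gamma c a x₀ ≤ √((1 - √(c * x₀ i)) / 2) :=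
  csInf_le gammaSet_finite.bddBelow (Or.inl (Or.inr ⟨_, ⟨⟨i, rfl⟩, h0, h1⟩, rfl⟩))

end Gamma

section TotalOutput

variable {n : ℕ} {α : ℝ} {y₀ : Fin n → ℝ}

/-- As long as an agent with initial output at least `1` has not moved, the moves of the others
are to `0`. -/
lemma profileAfter_eq_zero_of_large (hα : 0 ≤ α) (hy : ∀ i, 0 ≤ y₀ i) {j : Fin n}
    (hj1 : 1 ≤ y₀ j) {h : List (Fin n)} (hj : j ∉ h) {i : Fin n} (hi : i ∈ h) :
    profileAfter 1 α y₀ h i = 0 := by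
  induction h with
  | nil => simp at hi
  | cons k h ih =>
    rw [List.mem_cons, not_or] at hj
    by_cases hik : i = k
    · subst hik
      rw [profileAfter, move_one_same]
      refine br_of_one_le ?_
      have h1 := add_le_sum (profileAfter_nonneg hα hy h) (Ne.symm hj.1)
      rw [profileAfter_of_notMem (i := j) hj.2] at h1
      linarith
    · rw [profileAfter, move_of_ne _ hik]
      exact ih hj.2 ((List.mem_cons.1 hi).resolve_left hik)

/-- When the total output is at most `1/2`, the last mover accounts for at least half of it. -/
lemma half_le_last (hα : 0 ≤ α) (hy : ∀ i, 0 ≤ y₀ i) {i : Fin n} {h : List (Fin n)}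
    (hs : ∑ j, profileAfter 1 α y₀ (i :: h) j ≤ 1 / 2) :
    (∑ j, profileAfter 1 α y₀ (i :: h) j) / 2 ≤ profileAfter 1 α y₀ (i :: h) i := by
  have h1 := profileAfter_cons_same (α := α) y₀ i h
  have h2 := sum_sub_nonneg (profileAfter_nonneg hα hy (i :: h)) i
  set x := profileAfter 1 α y₀ (i :: h)
  set s := ∑ j, x j
  have hx := profileAfter_nonneg hα hy (i :: h) i
  rcases h2.eq_or_lt with h0 | h0
  · have : s = x i := by linarith
    change 0 ≤ x i at hx
    linarith
  · change 0 ≤ x i at hx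
    have h3 := br_of_le_one (α := α) h0 (by linarith)
    have h4 : s = √(s - x i) := by linarith
    have h5 := Real.sq_sqrt h0.le
    rw [← h4] at h5
    nlinarith

lemma zero_or_le_others {x : Fin n → ℝ} {j : Fin n} {g : ℝ} (hx : ∀ i, 0 ≤ x i)
    (hg : ∀ i, i ≠ j → x i = 0 ∨ g ≤ x i) : ∑ k, x k - x j = 0 ∨ g ≤ ∑ k, x k - x j := by
  by_cases hex : ∃ i, i ≠ j ∧ g ≤ x i
  · obtain ⟨i, hij, hi⟩ := hex
    right
    linarith [add_le_sum hx hij]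
  · left
    push Not at hex
    have : ∑ k, x k = x j := Finset.sum_eq_single_of_mem j (Finset.mem_univ j) fun i _ hij =>
      (hg i hij).resolve_right (not_le.2 (hex i hij))
    rw [this, sub_self]

lemma gamma_le_br_add (hα : 0 < α) (hα' : α < 1 / 4) {Y : ℝ}
    (hY : Y = 0 ∨ gamma 1 α y₀ ^ 2 ≤ Y) : gamma 1 α y₀ ≤ Y + br α Y := by
  have h1 : 0 < gamma 1 α y₀ := gamma_pos (by simpa using hα)
  have h2 : gamma 1 α y₀ ≤ α := by simpa using gamma_le (c := 1) (a := α) (x₀ := y₀)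
  rcases hY with rfl | hY
  · rw [br_zero]; linarith
  · exact le_br_add h1 (by linarith) hY

lemma initial_zero_or_gamma_le (hα : 0 < α) (hα' : α < 1 / 4) (hy : ∀ i, 0 ≤ y₀ i) (i : Fin n) :
    y₀ i = 0 ∨ gamma 1 α y₀ ≤ y₀ i := by
  have h2 : gamma 1 α y₀ ≤ α := by simpa using gamma_le (c := 1) (a := α) (x₀ := y₀)
  rcases (hy i).eq_or_lt with h | h
  · exact Or.inl h.symm
  · right
    rcases lt_or_ge (y₀ i) 1 with h1 | h1
    · simpa using gamma_le_of_interior (c := 1) (a := α) (x₀ := y₀) (i := i) (by simpa using h)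
        (by simpa using h1)
    · linarith

/-- From a total output of at least `√y`, where `y < 1` is an output that has not changed yet,
removing `y` leaves at least `γ²`. -/
lemma gamma_sq_le_sub (hα : 0 < α) {j : Fin n}
    (hj0 : 1 / 4 < y₀ j) (hj1 : y₀ j < 1) {s : ℝ} (hs : √(y₀ j) ≤ s) :
    gamma 1 α y₀ ^ 2 ≤ s - y₀ j := by
  have h1 : 0 < gamma 1 α y₀ := gamma_pos (by simpa using hα)
  have h2 := gamma_le_sqrt_of_interior (c := 1) (a := α) (x₀ := y₀) (i := j)
    (by linarith) (by linarith)
  rw [one_mul] at h2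
  have h3 : √(y₀ j) < 1 := (Real.sqrt_lt' one_pos).2 (by simpa using hj1)
  have h4 : gamma 1 α y₀ ^ 2 ≤ (1 - √(y₀ j)) / 2 := (Real.le_sqrt' h1).1 h2
  have h5 : 1 / 2 ≤ √(y₀ j) := Real.le_sqrt_of_sq_le (by linarith)
  have h6 := Real.sq_sqrt (show 0 ≤ y₀ j by linarith)
  nlinarith

/-- After the first move the total output never drops below `γ`. A drop requires that nearly all
output belongs to an agent who has not moved yet, and such an agent's initial output `y` controls
what the best responses of the others to it leave behind: `√y - y ≥ γ²` if `y < 1`, and only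
initial outputs if `y ≥ 1`. -/
lemma gamma_le_total (hα : 0 < α) (hα' : α < 1 / 4) (hy : ∀ i, 0 ≤ y₀ i) (j : Fin n)
    (h : List (Fin n)) : gamma 1 α y₀ ≤ ∑ k, profileAfter 1 α y₀ (j :: h) k := by
  have hγ : 0 < gamma 1 α y₀ := gamma_pos (by simpa using hα)
  have hγα : gamma 1 α y₀ ≤ α := by simpa using gamma_le (c := 1) (a := α) (x₀ := y₀)
  have hγsq : gamma 1 α y₀ ^ 2 ≤ gamma 1 α y₀ / 2 := by nlinarith
  induction h generalizing j with
  | nil =>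
    rw [profileAfter, sum_move, profileAfter]
    refine gamma_le_br_add hα hα' ?_
    refine (zero_or_le_others hy fun i _ => initial_zero_or_gamma_le hα hα' hy i).imp_right ?_
    intro h; linarith
  | cons i h ih =>
    have hs := ih i
    by_cases hji : j = i
    · subst hji; rw [profileAfter_cons_cons]; exact hs
    rw [profileAfter, sum_move]
    refine gamma_le_br_add hα hα' ?_
    have hlast := half_le_last hα.le hy (i := i) (h := h)
    have hx := profileAfter_nonneg hα.le hy (i :: h)
    have hbr := profileAfter_cons_same (α := α) y₀ i h
    have hYi := sum_sub_nonneg hx i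
    have hij := add_le_sum hx hji
    have hzero : ∀ hj : j ∉ i :: h, 1 ≤ y₀ j → ∀ k ∈ i :: h,
        profileAfter 1 α y₀ (i :: h) k = 0 := fun hj hj1 k hk =>
      profileAfter_eq_zero_of_large hα.le hy hj1 hj hk
    have hun : ∀ k, k ∉ i :: h → profileAfter 1 α y₀ (i :: h) k = y₀ k := fun k hk =>
      profileAfter_of_notMem hk
    have hquart : j ∈ i :: h → profileAfter 1 α y₀ (i :: h) j ≤ 1 / 4 :=
      profileAfter_le_quarter hα.le hα'.le hy
    set x := profileAfter 1 α y₀ (i :: h)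
    set s := ∑ k, x k
    rcases le_or_gt s (1 / 2) with hs2 | hs2
    · right
      have := hlast hs2
      linarith
    rcases le_or_gt (x j) (1 / 4) with hxj | hxj
    · right; nlinarith
    have hj : j ∉ i :: h := fun hj => not_lt.2 (hquart hj) hxj
    have hxy := hun j hj
    rcases lt_or_ge (y₀ j) 1 with hj1 | hj1
    · right
      rw [hxy] at hxj ⊢
      refine gamma_sq_le_sub hα hxj hj1 ?_
      have hYpos : 0 < s - x i := by linarith
      rcases le_or_gt (s - x i) 1 with hY1 | hY1
      · have h3 := br_of_le_one (α := α) hYpos hY1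
        have h4 : s = √(s - x i) := by linarith
        rw [h4]
        exact Real.sqrt_le_sqrt (by linarith)
      · have h3 : √(y₀ j) ≤ 1 := Real.sqrt_le_one.2 hj1.le
        linarith [hx i]
    · refine (zero_or_le_others (g := gamma 1 α y₀) hx fun k _ => ?_).imp_right fun h => by linarith
      by_cases hk : k ∈ i :: h
      · exact Or.inl (hzero hj hj1 k hk)
      · rw [hun k hk]; exact initial_zero_or_gamma_le hα hα' hy k

end TotalOutput

/-! ### The growth of a small total output -/

section Growth

variable {n : ℕ} {α : ℝ} {y₀ : Fin n → ℝ}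

/-- While the total output is at most `1/2`, a move of anybody but the last mover takes it from `s`
to at least `√(s / 2)`. -/
lemma sqrt_half_le_total (hα : 0 ≤ α) (hy : ∀ i, 0 ≤ y₀ i) {i j : Fin n} (hij : j ≠ i)
    {h : List (Fin n)} (hs0 : 0 < ∑ k, profileAfter 1 α y₀ (i :: h) k)
    (hs : ∑ k, profileAfter 1 α y₀ (i :: h) k ≤ 1 / 2) :
    √((∑ k, profileAfter 1 α y₀ (i :: h) k) / 2) ≤
      ∑ k, profileAfter 1 α y₀ (j :: i :: h) k := by
  rw [profileAfter.eq_2 _ _ _ j, sum_move]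
  have h1 := half_le_last hα hy hs
  have h2 := add_le_sum (profileAfter_nonneg hα hy (i :: h)) hij
  refine le_br_add (Real.sqrt_pos.2 (by linarith)) (Real.sqrt_le_one.2 (by linarith)) ?_
  rw [Real.sq_sqrt (by linarith)]
  linarith

lemma half_le_total {x : Fin n → ℝ} {j : Fin n}
    (hs : 1 / 2 ≤ ∑ k, x k) (hj : x j ≤ 1 / 4) : 1 / 2 ≤ ∑ k, move 1 α x j k := by
  rw [sum_move]
  exact le_br_add (by norm_num) (by norm_num) (by linarith)

/-- Once everybody has moved, a total output of at least `9/20` is never lost again. -/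
lemma total_ge_of_total_ge (hα : 0 ≤ α) (hα' : α ≤ 1 / 4) (hy : ∀ i, 0 ≤ y₀ i)
    {h : List (Fin n)} (hall : ∀ i, i ∈ h) (hs : 9 / 20 ≤ ∑ k, profileAfter 1 α y₀ h k)
    (j : Fin n) : 9 / 20 ≤ ∑ k, profileAfter 1 α y₀ (j :: h) k := by
  rcases le_or_gt (∑ k, profileAfter 1 α y₀ h k) (1 / 2) with hs2 | hs2
  · obtain _ | ⟨i, h⟩ := h
    · exact absurd (hall j) (by simp)
    by_cases hji : j = i
    · subst hji; rw [profileAfter_cons_cons]; exact hs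
    · refine le_trans ?_ (sqrt_half_le_total hα hy hji (by linarith) hs2)
      exact Real.le_sqrt_of_sq_le (by linarith)
  · refine le_trans (by norm_num) (half_le_total hs2.le ?_)
    exact profileAfter_le_quarter hα hα' hy (hall j)

/-- The potential of the growth phase, `log (1 / (2 s))` where this is positive. -/
def deficit (x : Fin n → ℝ) : ℝ := max 0 (-Real.log (2 * ∑ k, x k))

lemma deficit_nonneg (x : Fin n → ℝ) : 0 ≤ deficit x := le_max_left _ _

lemma deficit_of_half_le {x : Fin n → ℝ} (hs : 1 / 2 ≤ ∑ k, x k) : deficit x = 0 :=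
  max_eq_left (by linarith [Real.log_nonneg (show 1 ≤ 2 * ∑ k, x k by linarith)])

lemma deficit_of_le_half {x : Fin n → ℝ} (hs0 : 0 < ∑ k, x k) (hs : ∑ k, x k ≤ 1 / 2) :
    deficit x = -Real.log (2 * ∑ k, x k) :=
  max_eq_right (by linarith [Real.log_nonpos (show 0 ≤ 2 * ∑ k, x k by linarith) (by linarith)])

/-- Any change of the mover halves the deficit. -/
lemma deficit_move_le (hα : 0 < α) (hα' : α < 1 / 4) (hy : ∀ i, 0 ≤ y₀ i) {i j : Fin n}
    (hij : j ≠ i) {h : List (Fin n)} (hall : ∀ i', i' ∈ i :: h) :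
    deficit (profileAfter 1 α y₀ (j :: i :: h)) ≤ deficit (profileAfter 1 α y₀ (i :: h)) / 2 := by
  have hs0 : 0 < ∑ k, profileAfter 1 α y₀ (i :: h) k :=
    lt_of_lt_of_le (gamma_pos (by simpa using hα)) (gamma_le_total hα hα' hy i h)
  rcases le_or_gt (∑ k, profileAfter 1 α y₀ (i :: h) k) (1 / 2) with hs | hs
  · have h1 := sqrt_half_le_total hα.le hy hij hs0 hs
    refine max_le (div_nonneg (deficit_nonneg _) (by norm_num)) ?_
    rw [deficit_of_le_half hs0 hs]
    set s := ∑ k, profileAfter 1 α y₀ (i :: h) k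
    have h2 : √(2 * s) ≤ 2 * ∑ k, profileAfter 1 α y₀ (j :: i :: h) k := by
      have : √(2 * s) = 2 * √(s / 2) := by
        rw [show 2 * s = 2 ^ 2 * (s / 2) by ring, Real.sqrt_mul (by norm_num),
          Real.sqrt_sq (by norm_num)]
      linarith
    have h3 := Real.log_le_log (Real.sqrt_pos.2 (by linarith)) h2
    rw [Real.log_sqrt (by linarith)] at h3
    linarith
  · have h1 := half_le_total (α := α) hs.le
      (profileAfter_le_quarter hα.le hα'.le hy (hall j))
    rw [← profileAfter.eq_2] at h1
    rw [deficit_of_half_le h1]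
    exact div_nonneg (deficit_nonneg _) (by norm_num)

/-- The deficit contracts by `3/4` in expectation if nobody moves with probability above `1/2`. -/
lemma sum_mover_deficit_le (hα : 0 < α) (hα' : α < 1 / 4) (hy : ∀ i, 0 ≤ y₀ i)
    {p : List (Fin n) → Fin n → ℝ} (hp : IsMoverLaw p) {i : Fin n} {h : List (Fin n)}
    (hU : p (i :: h) i ≤ 1 / 2) (hall : ∀ i', i' ∈ i :: h) :
    ∑ j, p (i :: h) j * deficit (profileAfter 1 α y₀ (j :: i :: h)) ≤
      3 / 4 * deficit (profileAfter 1 α y₀ (i :: h)) := by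
  set D := deficit (profileAfter 1 α y₀ (i :: h)) with hD
  have hD0 : 0 ≤ D := deficit_nonneg _
  calc ∑ j, p (i :: h) j * deficit (profileAfter 1 α y₀ (j :: i :: h))
      ≤ ∑ j, p (i :: h) j * (D / 2 + if j = i then D / 2 else 0) := by
        refine sum_mover_mono hp fun j _ => ?_
        split_ifs with hji
        · subst hji; rw [profileAfter_cons_cons, ← hD]; linarith
        · rw [add_zero]; exact deficit_move_le hα hα' hy hji hall
    _ = D / 2 + p (i :: h) i * (D / 2) := by
        simp only [mul_add, Finset.sum_add_distrib, ← Finset.sum_mul, hp.sum_eq_one, mul_ite,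
          mul_zero, Finset.sum_ite_eq', Finset.mem_univ, if_true, one_mul]
    _ ≤ 3 / 4 * D := by nlinarith

end Growth

/-! ### Waiting until everybody has moved -/

section Coupon

variable {n : ℕ} {p : List (Fin n) → Fin n → ℝ} {L : ℝ}

/-- The agents that do not move in the history `h`. -/
def unmoved (h : List (Fin n)) : Finset (Fin n) := Finset.univ.filter (· ∉ h)

lemma sum_mover_unmoved_le (hp : IsMoverLaw p) {h : List (Fin n)}
    (hL : ∀ i, h.head? ≠ some i → L ≤ p h i) :
    ∑ i, p h i * ((unmoved (i :: h)).card : ℝ) ≤ (1 - L) * (unmoved h).card := by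
  have hsub : ∀ i, unmoved (i :: h) = (unmoved h).erase i := by
    intro i; ext j; simp [unmoved]
  have h1 := sum_mover_le_sub (A := fun i => ((unmoved (i :: h)).card : ℝ))
    (V := (unmoved h).card) (L := L) (h := h) hp (unmoved h) ?_ ?_ ?_
  · linarith
  · intro i hi
    refine hL i fun hhead => ?_
    have : i ∈ h := List.mem_of_mem_head? hhead
    simp [unmoved, this] at hi
  · intro i _
    rw [hsub]
    exact_mod_cast Finset.card_erase_le
  · intro i hi
    simp only [hsub]
    rw [Finset.card_erase_of_mem hi, Nat.cast_sub (Finset.card_pos.2 ⟨i, hi⟩)]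
    simp

lemma unmoved_eq_empty {h : List (Fin n)} (hh : ((unmoved h).card : ℝ) < 1) (i : Fin n) :
    i ∈ h := by
  have h0 : (unmoved h).card = 0 := by
    have : (unmoved h).card < 1 := by exact_mod_cast hh
    omega
  have := Finset.eq_empty_iff_forall_notMem.1 (Finset.card_eq_zero.1 h0) i
  simpa [unmoved] using this

end Coupon

/-! ### Entering the region of moderate outputs -/

section Tame

variable {n : ℕ} {α : ℝ}

/-- The levels `11/20 = σ₀ < σ₁ < σ₂` of the total output. From a total output of at least
`σ_(b+1) = σ_b² + 1/4`, any move of an agent with output at most `1/4` leads to at least `σ_b`. -/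
def level : ℕ → ℝ
  | 0 => 11 / 20
  | b + 1 => level b ^ 2 + 1 / 4

/-- The agents whose output exceeds the best response `σ - σ²` that leads to the total output
`σ = level b`. -/
def excessive (b : ℕ) (x : Fin n → ℝ) : Finset (Fin n) :=
  Finset.univ.filter fun i => level b - level b ^ 2 < x i

lemma mem_excessive {b : ℕ} {x : Fin n → ℝ} {i : Fin n} :
    i ∈ excessive b x ↔ level b - level b ^ 2 < x i := by
  simp [excessive]

/-- The total output is at least `level b`, and at most `b` agents have an output that could bring
it below this level. -/
def Tame (b : ℕ) (x : Fin n → ℝ) : Prop :=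
  level b ≤ ∑ k, x k ∧ (excessive b x).card ≤ b

lemma half_lt_level {b : ℕ} (hb : b ≤ 2) : 1 / 2 < level b := by
  interval_cases b <;> norm_num [level]

lemma level_lt {b : ℕ} (hb : b ≤ 2) : level b < 14 / 25 := by
  interval_cases b <;> norm_num [level]

lemma level_le_succ {b : ℕ} : level b ≤ level (b + 1) := by
  rw [level]; nlinarith [sq_nonneg (level b - 1 / 2)]

/-- A best response that leads to a total output of at least `σ ≥ 1/2` is at most `σ - σ²`. -/
lemma br_le_of_le_add (hα' : α < 1 / 4) {Y σ : ℝ} (hY : 0 ≤ Y) (hσ : 1 / 2 ≤ σ) (hσ1 : σ ≤ 1)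
    (h : σ ≤ Y + br α Y) : br α Y ≤ σ - σ ^ 2 := by
  rcases hY.eq_or_lt with rfl | h0
  · rw [br_zero] at h; linarith
  rcases le_total Y 1 with h1 | h1
  · rw [br_add_of_le_one h0 h1] at h
    rw [br_of_le_one h0 h1]
    nlinarith [Real.sq_sqrt hY]
  · rw [br_of_one_le h1]; nlinarith

lemma excessive_move_subset {b : ℕ} (x : Fin n → ℝ) (j : Fin n) :
    (excessive b (move 1 α x j)).erase j ⊆ (excessive b x).erase j := by
  intro i hi
  rw [Finset.mem_erase] at hi ⊢
  refine ⟨hi.1, ?_⟩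
  have h2 := hi.2
  simp only [mem_excessive, move_of_ne x hi.1] at h2 ⊢
  exact h2

/-- A move that leads to a total output of at least `level b` is itself not excessive. -/
lemma excessive_move_of_le (hα' : α < 1 / 4) {b : ℕ} (hb : b ≤ 2) {x : Fin n → ℝ}
    (hx : ∀ i, 0 ≤ x i) {j : Fin n} (hs : level b ≤ ∑ k, move 1 α x j k) :
    excessive b (move 1 α x j) ⊆ (excessive b x).erase j := by
  have h1 : j ∉ excessive b (move 1 α x j) := by
    simp only [mem_excessive, not_lt]
    rw [move_one_same]
    rw [sum_move] at hs
    exact br_le_of_le_add hα' (sum_sub_nonneg hx j) (half_lt_level hb).le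
      (by linarith [level_lt hb]) hs
  rw [← Finset.erase_eq_of_notMem h1]
  exact excessive_move_subset x j

lemma level_le_total_of_not_excessive {b : ℕ} (hb : b ≤ 2) {x : Fin n → ℝ}
    (hs : level b ≤ ∑ k, x k) {j : Fin n} (hj : j ∉ excessive b x) :
    level b ≤ ∑ k, move 1 α x j k := by
  simp only [mem_excessive, not_lt] at hj
  rw [sum_move]
  exact le_br_add (by linarith [half_lt_level hb]) (by linarith [level_lt hb]) (by linarith)

lemma level_le_total_of_succ {b : ℕ} (hb : b ≤ 2) {x : Fin n → ℝ}
    (hs : level (b + 1) ≤ ∑ k, x k) {j : Fin n} (hj : x j ≤ 1 / 4) :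
    level b ≤ ∑ k, move 1 α x j k := by
  rw [level] at hs
  rw [sum_move]
  exact le_br_add (by linarith [half_lt_level hb]) (by linarith [level_lt hb]) (by linarith)

lemma excessive_anti {b b' : ℕ} (hbb : b ≤ b') (x : Fin n → ℝ) :
    excessive b x ⊆ excessive b' x := by
  have hanti : ∀ b, level (b + 1) - level (b + 1) ^ 2 ≤ level b - level b ^ 2 := by
    intro b
    have h1 := level_le_succ (b := b)
    have h3 : 11 / 20 ≤ level b := by
      clear h1
      induction b with
      | zero => norm_num [level]
      | succ b ih => exact ih.trans level_le_succ
    nlinarith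
  have : level b' - level b' ^ 2 ≤ level b - level b ^ 2 :=
    antitone_nat_of_succ_le (f := fun b => level b - level b ^ 2) hanti hbb
  intro i
  simp only [mem_excessive]
  intro h; linarith

lemma level_mono : Monotone level := monotone_nat_of_le_succ fun _ => level_le_succ

/-- The region is kept by every move of an agent whose output is not excessive. -/
lemma Tame.move (hα' : α < 1 / 4) {b : ℕ} (hb : b ≤ 2) {x : Fin n → ℝ} (hx : ∀ i, 0 ≤ x i)
    (h : Tame b x) {j : Fin n} (hj : j ∉ excessive b x) : Tame b (move 1 α x j) := by
  have h1 := level_le_total_of_not_excessive (α := α) hb h.1 hj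
  refine ⟨h1, le_trans (Finset.card_le_card ?_) h.2⟩
  exact (excessive_move_of_le hα' hb hx h1).trans (Finset.erase_subset _ _)

/-- A move of an agent whose output is excessive removes this output. -/
lemma Tame.move_of_mem (hα' : α < 1 / 4) {b : ℕ} (hb : b + 1 ≤ 2) {x : Fin n → ℝ}
    (hx : ∀ i, 0 ≤ x i) (hx' : ∀ i, x i ≤ 1 / 4) (h : Tame (b + 1) x) {j : Fin n}
    (hj : j ∈ excessive (b + 1) x) : Tame b (LotteryContest.move 1 α x j) := by
  have h1 := level_le_total_of_succ (α := α) (b := b) (by omega) h.1 (hx' j)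
  refine ⟨h1, ?_⟩
  have h2 := Finset.card_le_card ((excessive_move_of_le hα' (by omega) hx h1).trans
    (Finset.erase_subset_erase j (excessive_anti (Nat.le_succ b) x)))
  rw [Finset.card_erase_of_mem hj] at h2
  have := h.2
  omega

lemma Tame.zero_of_empty {b : ℕ} {x : Fin n → ℝ} (h : Tame b x)
    (he : excessive b x = ∅) : Tame 0 x := by
  refine ⟨(level_mono (Nat.zero_le b)).trans h.1, ?_⟩
  have := excessive_anti (Nat.zero_le b) x
  rw [he, Finset.subset_empty] at this
  simp [this]

open Classical in
/-- The potential of this phase. Each improvement of the profile on the way to `Tame 0` lowers it by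
at least `1`. -/
def rank (x : Fin n → ℝ) : ℝ :=
  if Tame 0 x then 0 else if Tame 1 x then 1 else if Tame 2 x then 2
  else if ∑ k, x k < level 2 then 3 else 3 + (excessive 2 x).card

lemma rank_nonneg (x : Fin n → ℝ) : 0 ≤ rank x := by
  unfold rank
  split_ifs <;> positivity

lemma rank_le_add (x : Fin n → ℝ) : rank x ≤ 3 + (excessive 2 x).card := by
  have : (0 : ℝ) ≤ (excessive 2 x).card := by positivity
  unfold rank
  split_ifs <;> linarith

lemma rank_le_three {x : Fin n → ℝ} (h : ∑ k, x k < level 2) : rank x ≤ 3 := by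
  unfold rank
  split_ifs <;> norm_num

lemma rank_le_of_tame {b : ℕ} (hb : b ≤ 2) {x : Fin n → ℝ} (h : Tame b x) : rank x ≤ b := by
  unfold rank
  interval_cases b <;> split_ifs <;> norm_num

lemma tame_of_rank_lt_one {x : Fin n → ℝ} (h : rank x < 1) : Tame 0 x := by
  by_contra h0
  revert h
  unfold rank
  have : (0 : ℝ) ≤ (excessive 2 x).card := by positivity
  split_ifs <;> first | (norm_num; done) | (intro h; linarith)

/-- Below the level `σ₂` at most two outputs are excessive. -/
lemma card_excessive_le_two {x : Fin n → ℝ} (hx : ∀ i, 0 ≤ x i)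
    (hs : ∑ k, x k < level 2) : (excessive 2 x).card ≤ 2 := by
  by_contra hcon
  have h3 : (3 : ℝ) ≤ (excessive 2 x).card := by exact_mod_cast not_le.1 hcon
  have h1 : (excessive 2 x).card • (level 2 - level 2 ^ 2) ≤ ∑ i ∈ excessive 2 x, x i := by
    refine Finset.card_nsmul_le_sum _ _ _ fun i hi => ?_
    exact (mem_excessive.1 hi).le
  rw [nsmul_eq_mul] at h1
  have h2 : ∑ i ∈ excessive 2 x, x i ≤ ∑ i, x i :=
    Finset.sum_le_sum_of_subset_of_nonneg (Finset.subset_univ _) fun i _ _ => hx i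
  norm_num [level] at h1 h2 hs
  nlinarith

/-- Below the level `σ₂`, there is an agent whose move lifts the total output to at least `σ₂`:
besides the last mover, two outputs too large for this would exceed what the others produce. -/
lemma exists_jump (hn : 3 ≤ n) {x : Fin n → ℝ} (hx : ∀ i, 0 ≤ x i)
    (hs0 : 9 / 20 ≤ ∑ k, x k) (hs : ∑ k, x k < level 2) {i : Fin n} (hi : x i ≤ 1 / 4)
    (hbr : x i = br α (∑ k, x k - x i)) :
    ∃ k, k ≠ i ∧ level 2 ≤ ∑ j, move 1 α x k j := by
  set s := ∑ k, x k with hsdef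
  have hY : 0 < s - x i := by linarith
  have hlev := level_lt (b := 2) le_rfl
  have h1 := br_of_le_one (α := α) hY (by linarith [hx i])
  have h2 : s = √(s - x i) := by linarith
  have h3 := Real.sq_sqrt hY.le
  rw [← h2] at h3
  have hcard : 1 < (Finset.univ.erase i).card := by
    rw [Finset.card_erase_of_mem (Finset.mem_univ i), Finset.card_univ, Fintype.card_fin]; omega
  obtain ⟨k, hk, l, hl, hkl⟩ := Finset.one_lt_card.1 hcard
  have hki := Finset.ne_of_mem_erase hk
  have hli := Finset.ne_of_mem_erase hl
  have key : ∀ j, x j ≤ s - level 2 ^ 2 → level 2 ≤ ∑ m, move 1 α x j m := by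
    intro j hj
    rw [sum_move]
    exact le_br_add (by linarith [half_lt_level (b := 2) le_rfl]) (by linarith) (by linarith)
  by_contra! hcon
  have hk' : s - level 2 ^ 2 < x k := not_le.1 fun h => absurd (key k h) (not_le.2 (hcon k hki))
  have hl' : s - level 2 ^ 2 < x l := not_le.1 fun h => absurd (key l h) (not_le.2 (hcon l hli))
  have hsum : x i + (x k + x l) ≤ s := by
    have : ∑ m ∈ {i, k, l}, x m ≤ s :=
      Finset.sum_le_sum_of_subset_of_nonneg (Finset.subset_univ _) fun m _ _ => hx m
    rwa [Finset.sum_insert (by simp [hki.symm, hli.symm]), Finset.sum_pair hkl] at this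
  have hlv : level 2 = 88841 / 160000 := by norm_num [level]
  rw [hlv] at hk' hl'
  nlinarith

/-- The rank contracts by `1 - L / 3` in expectation. The last mover is the only agent with possibly
small probability to move, and its move is never needed for an improvement. -/
lemma sum_mover_rank_le (hn : 3 ≤ n) (hα : 0 < α) (hα' : α < 1 / 4) {y₀ : Fin n → ℝ}
    (hy : ∀ i, 0 ≤ y₀ i)
    {p : List (Fin n) → Fin n → ℝ} (hp : IsMoverLaw p) {L : ℝ} (hL0 : 0 ≤ L) {i : Fin n}
    {h : List (Fin n)} (hL : ∀ j, j ≠ i → L ≤ p (i :: h) j) (hall : ∀ i', i' ∈ i :: h)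
    (hs0 : 9 / 20 ≤ ∑ k, profileAfter 1 α y₀ (i :: h) k) :
    ∑ j, p (i :: h) j * rank (profileAfter 1 α y₀ (j :: i :: h)) ≤
      (1 - L / 3) * rank (profileAfter 1 α y₀ (i :: h)) := by
  have hx := profileAfter_nonneg hα.le hy (i :: h)
  have hx' : ∀ j, profileAfter 1 α y₀ (i :: h) j ≤ 1 / 4 := fun j =>
    profileAfter_le_quarter hα.le hα'.le hy (hall j)
  have hbr := profileAfter_cons_same (α := α) y₀ i h
  have hmv : ∀ j, profileAfter 1 α y₀ (j :: i :: h) =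
      move 1 α (profileAfter 1 α y₀ (i :: h)) j := fun j => rfl
  simp only [hmv]
  set x := profileAfter 1 α y₀ (i :: h)
  have hlast : ∀ b ≤ 2, level b ≤ ∑ k, x k → i ∉ excessive b x := by
    intro b hb hs
    simp only [mem_excessive, not_lt]
    rw [hbr]
    refine br_le_of_le_add hα' (sum_sub_nonneg hx i) (half_lt_level hb).le
      (by linarith [level_lt hb]) ?_
    rw [← hbr]; linarith
  have hmem : ∀ b ≤ 2, level b ≤ ∑ k, x k → ∀ j ∈ excessive b x, L ≤ p (i :: h) j :=
    fun b hb hs j hj => hL j fun hji => hlast b hb hs (hji ▸ hj)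
  -- a tame profile that is not yet `Tame 0` improves with the move of any excessive agent
  have htame : ∀ b, b + 1 ≤ 2 → Tame (b + 1) x → ¬ Tame 0 x → rank x = (b + 1 : ℕ) →
      ∑ j, p (i :: h) j * rank (move 1 α x j) ≤ (1 - L / 3) * rank x := by
    intro b hb ht ht0 hr
    obtain ⟨k, hk⟩ : (excessive (b + 1) x).Nonempty :=
      Finset.nonempty_iff_ne_empty.2 fun he => ht0 (ht.zero_of_empty he)
    have hb' : (b : ℝ) + 1 ≤ 2 := by exact_mod_cast hb
    have hdown : ∀ j ∈ excessive (b + 1) x, rank (move 1 α x j) ≤ b := fun j hj =>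
      rank_le_of_tame (by omega) (ht.move_of_mem hα' hb hx hx' hj)
    have h1 := sum_mover_le_sub (A := fun j => rank (move 1 α x j)) (V := (b + 1 : ℕ)) (L := L)
      (h := i :: h) hp {k} ?_ ?_ ?_
    · rw [hr]
      push_cast at h1 ⊢
      simp only [Finset.card_singleton] at h1
      push_cast at h1
      nlinarith
    · intro j hj
      rw [Finset.mem_singleton] at hj
      exact hj ▸ hmem _ hb ht.1 k hk
    · intro j _
      by_cases hj : j ∈ excessive (b + 1) x
      · exact (hdown j hj).trans (by push_cast; linarith)
      · exact rank_le_of_tame hb (ht.move hα' hb hx hj)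
    · intro j hj
      rw [Finset.mem_singleton] at hj
      have := hdown j (hj ▸ hk)
      push_cast
      linarith
  by_cases ht0 : Tame 0 x
  · have hr : rank x = 0 := by simp [rank, ht0]
    rw [hr, mul_zero]
    refine Finset.sum_nonpos fun j _ => mul_nonpos_of_nonneg_of_nonpos (hp.nonneg _ _) ?_
    have he : excessive 0 x = ∅ := Finset.card_eq_zero.1 (Nat.le_zero.1 ht0.2)
    simpa using rank_le_of_tame (by omega) (ht0.move hα' (by omega) hx (j := j) (by simp [he]))
  by_cases ht1 : Tame 1 x
  · exact htame 0 (by omega) ht1 ht0 (by simp [rank, ht0, ht1])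
  by_cases ht2 : Tame 2 x
  · exact htame 1 (by omega) ht2 ht0 (by simp [rank, ht0, ht1, ht2])
  rcases lt_or_ge (∑ k, x k) (level 2) with hs | hs
  · have hr : rank x = 3 := by simp [rank, ht0, ht1, ht2, hs]
    have hup : ∀ j, level 2 ≤ ∑ k, move 1 α x j k → rank (move 1 α x j) ≤ 2 := by
      intro j hj
      refine rank_le_of_tame (b := 2) le_rfl ⟨hj, ?_⟩
      exact (Finset.card_le_card ((excessive_move_of_le hα' le_rfl hx hj).trans
        (Finset.erase_subset _ _))).trans (card_excessive_le_two hx hs)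
    obtain ⟨k, hki, hk⟩ := exists_jump hn hx hs0 hs (hx' i) hbr
    have h1 := sum_mover_le_sub (A := fun j => rank (move 1 α x j)) (V := 3) (L := L)
      (h := i :: h) hp {k} ?_ ?_ ?_
    · rw [hr]
      simp only [Finset.card_singleton] at h1
      push_cast at h1
      linarith
    · intro j hj
      rw [Finset.mem_singleton] at hj
      exact hj ▸ hL k hki
    · intro j _
      rcases lt_or_ge (∑ l, move 1 α x j l) (level 2) with hj | hj
      · exact rank_le_three hj
      · linarith [hup j hj]
    · intro j hj
      rw [Finset.mem_singleton] at hj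
      have := hup j (hj ▸ hk)
      linarith
  · have hr : rank x = 3 + (excessive 2 x).card := by
      simp [rank, ht0, ht1, ht2, not_lt.2 hs]
    have hm : 3 ≤ (excessive 2 x).card := by
      by_contra hcon
      exact ht2 ⟨hs, by omega⟩
    have hm' : (3 : ℝ) ≤ (excessive 2 x).card := by exact_mod_cast hm
    have hdown : ∀ j ∈ excessive 2 x,
        rank (move 1 α x j) ≤ 3 + (excessive 2 x).card - 1 := by
      intro j hj
      rcases lt_or_ge (∑ l, move 1 α x j l) (level 2) with hj' | hj'
      · linarith [rank_le_three hj']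
      · have h2 := Finset.card_le_card (excessive_move_of_le hα' le_rfl hx hj')
        rw [Finset.card_erase_of_mem hj] at h2
        have h3 : ((excessive 2 (move 1 α x j)).card : ℝ) + 1 ≤ (excessive 2 x).card := by
          exact_mod_cast (by omega : (excessive 2 (move 1 α x j)).card + 1 ≤ (excessive 2 x).card)
        linarith [rank_le_add (move 1 α x j)]
    have h1 := sum_mover_le_sub (A := fun j => rank (move 1 α x j))
      (V := 3 + (excessive 2 x).card) (L := L) (h := i :: h) hp
      (excessive 2 x) (hmem 2 le_rfl hs) ?_ hdown
    · rw [hr]; nlinarith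
    · intro j _
      by_cases hj : j ∈ excessive 2 x
      · linarith [hdown j hj]
      · have h2 := level_le_total_of_not_excessive (α := α) le_rfl hs hj
        have h3 := Finset.card_le_card ((excessive_move_of_le hα' le_rfl hx h2).trans
          (Finset.erase_subset _ _))
        have h4 : ((excessive 2 (move 1 α x j)).card : ℝ) ≤ (excessive 2 x).card := by
          exact_mod_cast h3
        linarith [rank_le_add (move 1 α x j)]

end Tame

/-! ### The convex potential -/

section Potential

variable {n : ℕ} {α : ℝ}

/-- The strictly convex function that every move of the dynamics minimizes in the coordinate of
the mover, as long as the outputs are moderate. -/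
def potential (x : Fin n → ℝ) : ℝ :=
  ((∑ i, x i) ^ 2 - ∑ i, x i) / 2 + ∑ i, √(1 - 4 * x i) ^ 3 / 12

/-- The profile in which everybody produces the equilibrium output `(n - 1) / n²`. -/
def equilibrium (n : ℕ) : Fin n → ℝ := fun _ => (n - 1) / (n : ℝ) ^ 2

/-- Strong convexity of the separable part of the potential. -/
lemma cube_ge {z w : ℝ} (hz : z ∈ Set.Icc (0 : ℝ) (1 / 4)) (hw : w ∈ Set.Icc (0 : ℝ) (1 / 4)) :
    -(√(1 - 4 * z) / 2) * (w - z) + (w - z) ^ 2 / 2 ≤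
      √(1 - 4 * w) ^ 3 / 12 - √(1 - 4 * z) ^ 3 / 12 := by
  have h1 := Real.sq_sqrt (show 0 ≤ 1 - 4 * z by linarith [hz.2])
  have h2 := Real.sq_sqrt (show 0 ≤ 1 - 4 * w by linarith [hw.2])
  have h3 : √(1 - 4 * z) ≤ 1 := Real.sqrt_le_one.2 (by linarith [hz.1])
  have h4 : √(1 - 4 * w) ≤ 1 := Real.sqrt_le_one.2 (by linarith [hw.1])
  have h5 := Real.sqrt_nonneg (1 - 4 * z)
  have h6 := Real.sqrt_nonneg (1 - 4 * w)
  set r := √(1 - 4 * z)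
  set q := √(1 - 4 * w)
  have hz' : z = (1 - r ^ 2) / 4 := by linarith
  have hw' : w = (1 - q ^ 2) / 4 := by linarith
  rw [hz', hw']
  have h7 : 0 ≤ 4 * (2 * q + r) - 3 * (r + q) ^ 2 := by nlinarith [mul_nonneg h5 h6]
  have h8 := mul_nonneg (sq_nonneg (q - r)) h7
  nlinarith

/-- Smoothness of the separable part of the potential, away from the output `1/4`. -/
lemma cube_le {z w : ℝ} (hz : z ≤ 99 / 400) (hw : w ≤ 99 / 400) :
    √(1 - 4 * w) ^ 3 / 12 - √(1 - 4 * z) ^ 3 / 12 ≤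
      -(√(1 - 4 * z) / 2) * (w - z) + 5 * (w - z) ^ 2 := by
  have h1 := Real.sq_sqrt (show 0 ≤ 1 - 4 * z by linarith)
  have h2 := Real.sq_sqrt (show 0 ≤ 1 - 4 * w by linarith)
  have h3 : 1 / 10 ≤ √(1 - 4 * z) := Real.le_sqrt_of_sq_le (by linarith)
  have h4 : 1 / 10 ≤ √(1 - 4 * w) := Real.le_sqrt_of_sq_le (by linarith)
  set r := √(1 - 4 * z)
  set q := √(1 - 4 * w)
  have hz' : z = (1 - r ^ 2) / 4 := by linarith
  have hw' : w = (1 - q ^ 2) / 4 := by linarith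
  rw [hz', hw']
  have h7 : 0 ≤ 30 * (r + q) ^ 2 - 4 * (2 * q + r) := by nlinarith
  have h8 := mul_nonneg (sq_nonneg (q - r)) h7
  nlinarith

lemma potential_sub (x y : Fin n → ℝ) :
    potential y - potential x = (∑ i, y i - ∑ i, x i) ^ 2 / 2 +
      ∑ i, ((∑ j, x j - 1 / 2) * (y i - x i) +
        (√(1 - 4 * y i) ^ 3 / 12 - √(1 - 4 * x i) ^ 3 / 12)) := by
  rw [Finset.sum_add_distrib, ← Finset.mul_sum, Finset.sum_sub_distrib, Finset.sum_sub_distrib]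
  unfold potential
  ring

lemma potential_ge (x y : Fin n → ℝ) (hx : ∀ i, x i ∈ Set.Icc (0 : ℝ) (1 / 4))
    (hy : ∀ i, y i ∈ Set.Icc (0 : ℝ) (1 / 4)) :
    (∑ i, y i - ∑ i, x i) ^ 2 / 2 +
      ∑ i, ((∑ j, x j - 1 / 2 - √(1 - 4 * x i) / 2) * (y i - x i) + (y i - x i) ^ 2 / 2) ≤
    potential y - potential x := by
  rw [potential_sub]
  refine add_le_add le_rfl (Finset.sum_le_sum fun i _ => ?_)
  linarith [cube_ge (hx i) (hy i)]

lemma potential_update_sub (x : Fin n → ℝ) (i : Fin n) (w : ℝ) :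
    potential (Function.update x i w) - potential x = (w - x i) ^ 2 / 2 +
      (∑ j, x j - 1 / 2) * (w - x i) + (√(1 - 4 * w) ^ 3 / 12 - √(1 - 4 * x i) ^ 3 / 12) := by
  rw [potential_sub, sum_update]
  refine (congrArg (_ + ·) (Finset.sum_eq_single_of_mem i (Finset.mem_univ i) ?_)).trans ?_
  · intro j _ hj; simp [hj]
  · simp only [Function.update_self]; ring

/-- A best response to an output of the others of at least `1/4` minimizes the potential. -/
lemma potential_move_le (hα' : α < 1 / 4) {x : Fin n → ℝ} {i : Fin n}
    (hY : 1 / 4 ≤ ∑ j, x j - x i) {w : ℝ} (hw : w ∈ Set.Icc (0 : ℝ) (1 / 4)) :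
    potential (move 1 α x i) ≤ potential (Function.update x i w) := by
  have h1 := potential_update_sub (move 1 α x i) i w
  have h2 : Function.update (move 1 α x i) i w = Function.update x i w := by
    simp [move]
  rw [h2, sum_move, move_one_same] at h1
  set Y := ∑ j, x j - x i
  have hb : br α Y ∈ Set.Icc (0 : ℝ) (1 / 4) := by
    refine ⟨?_, br_le_quarter hα'.le (by linarith)⟩
    rcases le_total Y 1 with h | h
    · rw [br_of_le_one (by linarith) h]
      have : Y ≤ √Y := Real.le_sqrt_of_sq_le (by nlinarith)
      linarith
    · rw [br_of_one_le h]
  have h3 := cube_ge hb hw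
  have h4 : 0 ≤ (Y + br α Y - 1 / 2 - √(1 - 4 * br α Y) / 2) * (w - br α Y) := by
    rcases le_total Y 1 with h | h
    · have h5 : √(1 - 4 * br α Y) = 2 * √Y - 1 := by
        rw [br_of_le_one (by linarith) h]
        have h6 : 1 / 2 ≤ √Y := Real.le_sqrt_of_sq_le (by linarith)
        rw [← Real.sqrt_sq (show 0 ≤ 2 * √Y - 1 by linarith)]
        congr 1
        linarith [Real.sq_sqrt (show 0 ≤ Y by linarith)]
      rw [h5, br_add_of_le_one (by linarith) h]
      apply le_of_eq; ring
    · rw [br_of_one_le h]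
      simp only [mul_zero, sub_zero, Real.sqrt_one]
      exact mul_nonneg (by linarith) hw.1
  nlinarith [sq_nonneg (w - br α Y)]

lemma sum_equilibrium (hn : 3 ≤ n) : ∑ i, equilibrium n i = 1 - 1 / n := by
  have : (n : ℝ) ≠ 0 := by positivity
  simp only [equilibrium, Finset.sum_const, Finset.card_univ, Fintype.card_fin, nsmul_eq_mul]
  field_simp

lemma equilibrium_mem (hn : 3 ≤ n) (i : Fin n) :
    equilibrium n i ∈ Set.Icc (0 : ℝ) (99 / 400) := by
  have h3 : (3 : ℝ) ≤ n := by exact_mod_cast hn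
  constructor
  · exact div_nonneg (by linarith) (by positivity)
  · rw [equilibrium, div_le_iff₀ (by positivity)]
    nlinarith

lemma sqrt_equilibrium (hn : 3 ≤ n) (i : Fin n) :
    √(1 - 4 * equilibrium n i) = 1 - 2 / n := by
  have h3 : (3 : ℝ) ≤ n := by exact_mod_cast hn
  have h4 : (2 : ℝ) / n ≤ 1 := by rw [div_le_one (by linarith)]; linarith
  rw [← Real.sqrt_sq (show 0 ≤ 1 - 2 / (n : ℝ) by linarith)]
  congr 1
  have : (n : ℝ) ≠ 0 := by positivity
  rw [equilibrium]
  field_simp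
  ring

/-- The excess of the potential over its value at the equilibrium. -/
def excess (x : Fin n → ℝ) : ℝ := potential x - potential (equilibrium n)

lemma excess_ge (hn : 3 ≤ n) {x : Fin n → ℝ} (hx : ∀ i, x i ∈ Set.Icc (0 : ℝ) (1 / 4)) :
    (∑ i, x i - (1 - 1 / n)) ^ 2 / 2 + ∑ i, (x i - equilibrium n i) ^ 2 / 2 ≤ excess x := by
  have h1 := potential_ge (equilibrium n) x
    (fun i => ⟨(equilibrium_mem hn i).1, (equilibrium_mem hn i).2.trans (by norm_num)⟩) hx
  rw [sum_equilibrium hn] at h1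
  refine le_trans (le_of_eq ?_) h1
  congr 1
  refine Finset.sum_congr rfl fun i _ => ?_
  rw [sqrt_equilibrium hn]
  ring

lemma excess_nonneg (hn : 3 ≤ n) {x : Fin n → ℝ} (hx : ∀ i, x i ∈ Set.Icc (0 : ℝ) (1 / 4)) :
    0 ≤ excess x :=
  le_trans (by positivity) (excess_ge hn hx)

lemma excess_le (hn : 3 ≤ n) {x : Fin n → ℝ} (hx : ∀ i, x i ∈ Set.Icc (0 : ℝ) (1 / 4)) :
    excess x ≤ (n : ℝ) ^ 2 := by
  have h3 : (3 : ℝ) ≤ n := by exact_mod_cast hn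
  have h1 : ∑ i, x i ≤ (n : ℝ) * (1 / 4) := by
    have := Finset.sum_le_card_nsmul Finset.univ x (1 / 4) fun i _ => (hx i).2
    rwa [Finset.card_univ, Fintype.card_fin, nsmul_eq_mul] at this
  have h0 : 0 ≤ ∑ i, x i := Finset.sum_nonneg fun i _ => (hx i).1
  have h2 : ∑ i, √(1 - 4 * x i) ^ 3 / 12 ≤ (n : ℝ) * (1 / 12) := by
    have := Finset.sum_le_card_nsmul Finset.univ (fun i => √(1 - 4 * x i) ^ 3 / 12) (1 / 12)
      fun i _ => by
        have h4 : √(1 - 4 * x i) ≤ 1 := Real.sqrt_le_one.2 (by linarith [(hx i).1])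
        have := pow_le_one₀ (n := 3) (Real.sqrt_nonneg _) h4
        linarith
    rwa [Finset.card_univ, Fintype.card_fin, nsmul_eq_mul] at this
  have h5 : -1 / 8 ≤ potential (equilibrium n) := by
    unfold potential
    have h6 : 0 ≤ ∑ i, √(1 - 4 * equilibrium n i) ^ 3 / 12 :=
      Finset.sum_nonneg fun i _ => by positivity
    nlinarith [sq_nonneg (∑ i, equilibrium n i - 1 / 2)]
  unfold excess
  rw [potential]
  nlinarith

/-- The excess contracts by `1 - L / 11` in expectation: moving a coordinate by `1/11` of the way
to the equilibrium recovers `1/11` of its share in the convexity bound for the excess, and the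
best response of the mover does at least as well. The last mover has nothing to gain. -/
lemma sum_mover_excess_le (hn : 3 ≤ n) (hα' : α < 1 / 4) {x : Fin n → ℝ}
    (hx : ∀ i, 0 ≤ x i) (ht : Tame 0 x) {i : Fin n} (hi : move 1 α x i = x)
    {p : List (Fin n) → Fin n → ℝ} (hp : IsMoverLaw p) {h : List (Fin n)} {L : ℝ} (hL0 : 0 ≤ L)
    (hL : ∀ j, j ≠ i → L ≤ p h j) :
    ∑ j, p h j * excess (move 1 α x j) ≤ (1 - L / 11) * excess x := by
  have hxle : ∀ j, x j ≤ 99 / 400 := by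
    intro j
    have he : excessive 0 x = ∅ := Finset.card_eq_zero.1 (Nat.le_zero.1 ht.2)
    have := mt mem_excessive.2 (Finset.eq_empty_iff_forall_notMem.1 he j)
    norm_num [level] at this
    exact this
  have hs : 11 / 20 ≤ ∑ j, x j := ht.1
  have hxI : ∀ j, x j ∈ Set.Icc (0 : ℝ) (1 / 4) := fun j => ⟨hx j, (hxle j).trans (by norm_num)⟩
  have heI : ∀ j, equilibrium n j ∈ Set.Icc (0 : ℝ) (1 / 4) := fun j =>
    ⟨(equilibrium_mem hn j).1, (equilibrium_mem hn j).2.trans (by norm_num)⟩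
  set s := ∑ j, x j with hsdef
  let t : Fin n → ℝ := fun j => (s - 1 / 2 - √(1 - 4 * x j) / 2) * (equilibrium n j - x j) +
    (equilibrium n j - x j) ^ 2 / 2
  have hconv : ∑ j, t j ≤ -excess x := by
    have h1 := potential_ge x (equilibrium n) hxI heI
    have h2 := sq_nonneg (∑ i, equilibrium n i - ∑ i, x i)
    change _ + ∑ j, t j ≤ _ at h1
    unfold excess
    linarith
  have hstep : ∀ j, excess (move 1 α x j) ≤ excess x + t j / 11 := by
    intro j
    have he := equilibrium_mem hn j
    have h1 := potential_move_le (x := x) (i := j) hα' (by linarith [hxle j])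
      (w := x j + (equilibrium n j - x j) / 11)
      ⟨by linarith [hx j, he.1], by linarith [hxle j, he.2]⟩
    have h2 := potential_update_sub x j (x j + (equilibrium n j - x j) / 11)
    have h3 := cube_le (hxle j) (w := x j + (equilibrium n j - x j) / 11)
      (by linarith [hxle j, he.2])
    simp only [excess, t]
    nlinarith
  have hle : ∀ j, excess (move 1 α x j) ≤ excess x := by
    intro j
    have h1 := potential_move_le (x := x) (i := j) hα' (by linarith [hxle j]) (hxI j)
    rw [Function.update_eq_self] at h1
    unfold excess; linarith
  have hkey : L * ∑ j, (excess x - excess (move 1 α x j)) ≤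
      ∑ j, p h j * (excess x - excess (move 1 α x j)) := by
    rw [Finset.mul_sum]
    refine Finset.sum_le_sum fun j _ => ?_
    by_cases hj : j = i
    · subst hj; rw [hi]; simp
    · exact mul_le_mul_of_nonneg_right (hL j hj) (sub_nonneg.2 (hle j))
  have h5 : excess x / 11 ≤ ∑ j, (excess x - excess (move 1 α x j)) := by
    have : ∑ j, -(t j / 11) ≤ ∑ j, (excess x - excess (move 1 α x j)) :=
      Finset.sum_le_sum fun j _ => by linarith [hstep j]
    rw [Finset.sum_neg_distrib, ← Finset.sum_div] at this
    linarith
  have h6 := mul_le_mul_of_nonneg_left h5 hL0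
  have h7 : ∑ j, p h j * (excess x - excess (move 1 α x j)) =
      excess x - ∑ j, p h j * excess (move 1 α x j) := by
    simp only [mul_sub, Finset.sum_sub_distrib, ← Finset.sum_mul, hp.sum_eq_one, one_mul]
  linarith

/-- A profile with nearly minimal potential is an approximate equilibrium. -/
lemma isApproxEquilibrium_of_excess_lt (hn : 3 ≤ n) {x : Fin n → ℝ}
    (hx : ∀ i, x i ∈ Set.Icc (0 : ℝ) (1 / 4)) {ε : ℝ} (hε : 0 < ε) (hε1 : ε ≤ 1)
    (hex : excess x < ε / (256 * (n : ℝ) ^ 2)) : IsApproxEquilibrium 1 ε x := by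
  have h3 : (3 : ℝ) ≤ n := by exact_mod_cast hn
  have hge := excess_ge hn hx
  obtain ⟨m, hm⟩ : ∃ m : ℝ, m = 1 / n := ⟨_, rfl⟩
  have hm0 : 0 < m := by rw [hm]; positivity
  have hm3 : m ≤ 1 / 3 := by rw [hm]; exact one_div_le_one_div_of_le (by norm_num) h3
  have he : ∀ i, equilibrium n i = (1 - m) - (1 - m) ^ 2 := by
    intro i
    have : (n : ℝ) ≠ 0 := by positivity
    rw [equilibrium, hm]; field_simp; ring
  rw [← hm] at hge
  have hex' : excess x < ε * m ^ 2 / 256 := by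
    refine hex.trans_le (le_of_eq ?_)
    have : (n : ℝ) ≠ 0 := by positivity
    rw [hm]; field_simp
  obtain ⟨ζ, hζ0, hζ⟩ : ∃ ζ : ℝ, 0 < ζ ∧ ζ ^ 2 = ε * m ^ 2 / 128 :=
    ⟨√(ε * m ^ 2 / 128), Real.sqrt_pos.2 (by positivity), Real.sq_sqrt (by positivity)⟩
  have hζm : ζ ≤ m / 11 := by
    refine abs_le_of_sq_le_sq' ?_ (by positivity) |>.2
    nlinarith [sq_nonneg m]
  have hsum0 : 0 ≤ ∑ i, (x i - equilibrium n i) ^ 2 / 2 :=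
    Finset.sum_nonneg fun i _ => by positivity
  have hs : |∑ i, x i - (1 - m)| ≤ ζ := by
    refine abs_le_of_sq_le_sq ?_ hζ0.le
    linarith
  have hxi : ∀ i, |x i - ((1 - m) - (1 - m) ^ 2)| ≤ ζ := by
    intro i
    refine abs_le_of_sq_le_sq ?_ hζ0.le
    have h1 := Finset.single_le_sum (f := fun i => (x i - equilibrium n i) ^ 2 / 2)
      (fun i _ => by positivity) (Finset.mem_univ i)
    rw [he i] at h1
    have h2 := sq_nonneg (∑ i, x i - (1 - m))
    linarith
  set s := ∑ i, x i
  have hs' := abs_le.1 hs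
  have hY : ∀ i, |√(s - x i) - (1 - m)| ≤ 3 * ζ ∧ 0 < s - x i := by
    intro i
    have h1 := abs_le.1 (hxi i)
    have h2 : 1 / 4 ≤ s - x i := by nlinarith
    have h4 := Real.sq_sqrt (show 0 ≤ s - x i by linarith)
    have h5 : 1 / 2 ≤ √(s - x i) := Real.le_sqrt_of_sq_le (by linarith)
    refine ⟨abs_le.2 ⟨?_, ?_⟩, by linarith⟩
    · by_contra hc
      nlinarith
    · by_contra hc
      nlinarith
  refine isApproxEquilibrium_of_gap hε1 (fun i => (hx i).1) (fun i => (hY i).2) fun i => ?_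
  have h1 := abs_le.1 (hY i).1
  change (s - √(s - x i)) ^ 2 / s ≤ ε * (1 - √(s - x i)) ^ 2
  set r := √(s - x i)
  have h4 : (s - r) ^ 2 ≤ (4 * ζ) ^ 2 := by
    apply sq_le_sq'
    · linarith
    · linarith
  have h5 : (m / 2) ^ 2 ≤ (1 - r) ^ 2 := by
    apply pow_le_pow_left₀ (by positivity)
    linarith
  rw [div_le_iff₀ (by linarith)]
  have h6 : ε * (m / 2) ^ 2 ≤ ε * (1 - r) ^ 2 := mul_le_mul_of_nonneg_left h5 hε.le
  have h7 : 1 / 2 ≤ s := by linarith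
  have h8 : ε * (m / 2) ^ 2 * (1 / 2) ≤ ε * (1 - r) ^ 2 * s :=
    mul_le_mul h6 h7 (by norm_num) (by positivity)
  nlinarith

end Potential

/-! ### The upper bound -/

section Upper

variable {n : ℕ} {α L ε δ : ℝ} {y₀ : Fin n → ℝ} {p : List (Fin n) → Fin n → ℝ}
  {I : List (Fin n) → Prop}

lemma Reaches.cons {c a : ℝ} {x₀ : Fin n → ℝ} {h : List (Fin n)} (H : Reaches c a ε x₀ h)
    (i : Fin n) : Reaches c a ε x₀ (i :: h) :=
  let ⟨h', hh, hx⟩ := H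
  ⟨h', hh.trans (List.suffix_cons i h), hx⟩

open Classical in
/-- The indicator of the failure to reach an approximate equilibrium. -/
def failure (α ε : ℝ) (y₀ : Fin n → ℝ) (h : List (Fin n)) : ℝ :=
  if Reaches 1 α ε y₀ h then 0 else 1

lemma failure_le_one (h : List (Fin n)) : failure α ε y₀ h ≤ 1 := by
  unfold failure; split_ifs <;> norm_num

lemma failure_nonneg (h : List (Fin n)) : 0 ≤ failure α ε y₀ h := by
  unfold failure; split_ifs <;> norm_num

lemma expect_failure_le_one (hp : IsMoverLaw p) (K : ℕ) (h : List (Fin n)) :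
    expect p K (failure α ε y₀) h ≤ 1 :=
  expect_le_one hp failure_le_one K h

/-- Once an approximate equilibrium has been reached, failure is impossible. -/
lemma expect_failure_of_reaches (hp : IsMoverLaw p) (K : ℕ) {h : List (Fin n)}
    (H : Reaches 1 α ε y₀ h) : expect p K (failure α ε y₀) h ≤ 0 := by
  have h1 := expect_mono hp (I := Reaches 1 α ε y₀) (fun h i hh _ => hh.cons i)
    (V := failure α ε y₀) (W := fun _ => 0) (fun h hh => by simp [failure, hh]) K H
  rwa [expect_const hp] at h1

/-- The convergence phase: in the region `Tame 0` the excess of the potential contracts. -/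
lemma expect_failure_of_tame (hn : 3 ≤ n) (hα : 0 < α) (hα' : α < 1 / 4) (hy : ∀ i, 0 ≤ y₀ i)
    (hp : IsMoverLaw p) (hI : IsClosedUnder p I) (hL0 : 0 ≤ L) (hL1 : L ≤ 1)
    (hL : ∀ h i, I h → h.head? ≠ some i → L ≤ p h i) (hε : 0 < ε) (hε1 : ε < 1)
    (K R : ℕ) {h : List (Fin n)} (hh : I h) (hall : ∀ i, i ∈ h)
    (ht : Tame 0 (profileAfter 1 α y₀ h)) :
    expect p (K + R) (failure α ε y₀) h ≤
      (1 - L / 11) ^ K * (n : ℝ) ^ 2 / (ε / (256 * (n : ℝ) ^ 2)) := by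
  have hn0 : (0 : ℝ) < n := by positivity
  have hbox : ∀ h : List (Fin n), (∀ i, i ∈ h) →
      ∀ i, profileAfter 1 α y₀ h i ∈ Set.Icc (0 : ℝ) (1 / 4) := fun h hh i =>
    ⟨profileAfter_nonneg hα.le hy h i, profileAfter_le_quarter hα.le hα'.le hy (hh i)⟩
  let J : List (Fin n) → Prop := fun h =>
    I h ∧ (∀ i, i ∈ h) ∧ Tame 0 (profileAfter 1 α y₀ h)
  have hJ : IsClosedUnder p J := by
    intro h i hh hi
    refine ⟨hI h i hh.1 hi, fun j => List.mem_cons_of_mem i (hh.2.1 j), ?_⟩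
    have he : excessive 0 (profileAfter 1 α y₀ h) = ∅ :=
      Finset.card_eq_zero.1 (Nat.le_zero.1 hh.2.2.2)
    exact hh.2.2.move hα' (by omega) (profileAfter_nonneg hα.le hy h) (by simp [he])
  rw [expect_add]
  have h1 := expect_le_add_of_contract hp hJ (V := fun h => excess (profileAfter 1 α y₀ h))
    (F := expect p R (failure α ε y₀)) (ρ := 1 - L / 11) (v := ε / (256 * (n : ℝ) ^ 2)) (d := 0)
    (by linarith) (by positivity) le_rfl (fun h hh => excess_nonneg hn (hbox h hh.2.1)) ?_
    (fun h _ => expect_failure_le_one hp R h) ?_ K (h := h) ⟨hh, hall, ht⟩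
  · rw [zero_add] at h1
    refine h1.trans ?_
    have h2 : 0 ≤ (1 - L / 11) ^ K := pow_nonneg (by linarith) K
    gcongr
    exact excess_le hn (hbox h hall)
  · intro h hh
    obtain _ | ⟨i, h⟩ := h
    · exact absurd (hh.2.1 ⟨0, by omega⟩) (by simp)
    refine sum_mover_excess_le hn hα' (profileAfter_nonneg hα.le hy _) hh.2.2 (i := i) ?_ hp hL0 ?_
    · rw [profileAfter, move_move]
    · intro j hj
      exact hL _ j hh.1 (by simpa using hj.symm)
  · intro h hh hlt
    exact expect_failure_of_reaches hp R
      ⟨h, List.suffix_rfl, isApproxEquilibrium_of_excess_lt hn (hbox h hh.2.1) hε hε1.le hlt⟩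

/-- The phase that leads from a total output of at least `9/20` to the region `Tame 0`. -/
lemma expect_failure_of_total_ge (hn : 3 ≤ n) (hα : 0 < α) (hα' : α < 1 / 4) (hy : ∀ i, 0 ≤ y₀ i)
    (hp : IsMoverLaw p) (hI : IsClosedUnder p I) (hL0 : 0 ≤ L) (hL1 : L ≤ 1)
    (hL : ∀ h i, I h → h.head? ≠ some i → L ≤ p h i) {d : ℝ} (hd : 0 ≤ d) {M : ℕ}
    (hM : ∀ h, I h → (∀ i, i ∈ h) → Tame 0 (profileAfter 1 α y₀ h) →
      expect p M (failure α ε y₀) h ≤ d)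
    (K : ℕ) {h : List (Fin n)} (hh : I h) (hall : ∀ i, i ∈ h)
    (hs : 9 / 20 ≤ ∑ i, profileAfter 1 α y₀ h i) :
    expect p (K + M) (failure α ε y₀) h ≤ d + (1 - L / 3) ^ K * (3 + n) := by
  let J : List (Fin n) → Prop := fun h =>
    I h ∧ (∀ i, i ∈ h) ∧ 9 / 20 ≤ ∑ i, profileAfter 1 α y₀ h i
  have hJ : IsClosedUnder p J := fun h i hh hi =>
    ⟨hI h i hh.1 hi, fun j => List.mem_cons_of_mem i (hh.2.1 j),
      total_ge_of_total_ge hα.le hα'.le hy hh.2.1 hh.2.2 i⟩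
  rw [expect_add]
  have h1 := expect_le_add_of_contract hp hJ (V := fun h => rank (profileAfter 1 α y₀ h))
    (F := expect p M (failure α ε y₀)) (ρ := 1 - L / 3) (v := 1) (d := d)
    (by linarith) one_pos hd (fun h _ => rank_nonneg _) ?_
    (fun h _ => expect_failure_le_one hp M h)
    (fun h hh hlt => hM h hh.1 hh.2.1 (tame_of_rank_lt_one hlt)) K (h := h) ⟨hh, hall, hs⟩
  · rw [div_one] at h1
    refine h1.trans ?_
    have h2 : 0 ≤ (1 - L / 3) ^ K := pow_nonneg (by linarith) K
    have h3 : ((excessive 2 (profileAfter 1 α y₀ h)).card : ℝ) ≤ n := by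
      have := Finset.card_le_univ (excessive 2 (profileAfter 1 α y₀ h))
      rw [Fintype.card_fin] at this
      exact_mod_cast this
    gcongr
    linarith [rank_le_add (profileAfter 1 α y₀ h)]
  · intro h hh
    obtain _ | ⟨i, h⟩ := h
    · exact absurd (hh.2.1 ⟨0, by omega⟩) (by simp)
    exact sum_mover_rank_le hn hα hα' hy hp hL0
      (fun j hj => hL _ j hh.1 (by simpa using hj.symm)) hh.2.1 hh.2.2

/-- The phase in which the total output, once everybody has moved, grows to `9/20`. -/
lemma expect_failure_of_all_moved (hn : 3 ≤ n) (hα : 0 < α) (hα' : α < 1 / 4)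
    (hy : ∀ i, 0 ≤ y₀ i) (hp : IsMoverLaw p) (hI : IsClosedUnder p I)
    (hU : ∀ h i, I h → p h i ≤ 1 / 2) {d : ℝ} (hd : 0 ≤ d) {M : ℕ}
    (hM : ∀ h, I h → (∀ i, i ∈ h) → 9 / 20 ≤ ∑ i, profileAfter 1 α y₀ h i →
      expect p M (failure α ε y₀) h ≤ d)
    (K : ℕ) {h : List (Fin n)} (hh : I h) (hall : ∀ i, i ∈ h) :
    expect p (K + M) (failure α ε y₀) h ≤
      d + (3 / 4) ^ K * Real.log (1 / gamma 1 α y₀) / (1 / 10) := by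
  have hγ : 0 < gamma 1 α y₀ := gamma_pos (by simpa using hα)
  have hγα : gamma 1 α y₀ ≤ α := by simpa using gamma_le (c := 1) (a := α) (x₀ := y₀)
  let J : List (Fin n) → Prop := fun h => I h ∧ ∀ i, i ∈ h
  have hJ : IsClosedUnder p J := fun h i hh hi =>
    ⟨hI h i hh.1 hi, fun j => List.mem_cons_of_mem i (hh.2 j)⟩
  have htot : ∀ h : List (Fin n), (∀ i, i ∈ h) →
      gamma 1 α y₀ ≤ ∑ i, profileAfter 1 α y₀ h i := by
    intro h hh
    obtain _ | ⟨i, h⟩ := h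
    · exact absurd (hh ⟨0, by omega⟩) (by simp)
    exact gamma_le_total hα hα' hy i h
  rw [expect_add]
  have h1 := expect_le_add_of_contract hp hJ (V := fun h => deficit (profileAfter 1 α y₀ h))
    (F := expect p M (failure α ε y₀)) (ρ := 3 / 4) (v := 1 / 10) (d := d)
    (by norm_num) (by norm_num) hd (fun h _ => deficit_nonneg _) ?_
    (fun h _ => expect_failure_le_one hp M h) ?_ K (h := h) ⟨hh, hall⟩
  · refine h1.trans ?_
    gcongr
    rw [one_div, Real.log_inv]
    refine max_le ?_ ?_
    · linarith [Real.log_nonpos hγ.le (by linarith)]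
    · have := Real.log_le_log hγ
        (show gamma 1 α y₀ ≤ 2 * ∑ i, profileAfter 1 α y₀ h i by linarith [htot h hall])
      linarith
  · intro h hh
    obtain _ | ⟨i, h⟩ := h
    · exact absurd (hh.2 ⟨0, by omega⟩) (by simp)
    exact sum_mover_deficit_le hα hα' hy hp (hU _ i hh.1) hh.2
  · intro h hh hlt
    refine hM h hh.1 hh.2 ?_
    have h2 : 0 < 2 * ∑ i, profileAfter 1 α y₀ h i := by linarith [htot h hh.2]
    have h3 : -(1 / 10) ≤ Real.log (2 * ∑ i, profileAfter 1 α y₀ h i) := by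
      have := le_max_right 0 (-Real.log (2 * ∑ i, profileAfter 1 α y₀ h i))
      change _ ≤ deficit _ at this
      linarith
    have h4 := (Real.le_log_iff_exp_le h2).1 h3
    linarith [Real.add_one_le_exp (-(1 / 10 : ℝ))]

/-- The phase in which everybody moves at least once. -/
lemma expect_failure_nil (hp : IsMoverLaw p) (hI : IsClosedUnder p I) (hI0 : I [])
    (hL1 : L ≤ 1) (hL : ∀ h i, I h → h.head? ≠ some i → L ≤ p h i) {d : ℝ} (hd : 0 ≤ d) {M : ℕ}
    (hM : ∀ h, I h → (∀ i, i ∈ h) → expect p M (failure α ε y₀) h ≤ d) (K : ℕ) :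
    expect p (K + M) (failure α ε y₀) [] ≤ d + (1 - L) ^ K * n := by
  rw [expect_add]
  have h1 := expect_le_add_of_contract hp hI (V := fun h => ((unmoved h).card : ℝ))
    (F := expect p M (failure α ε y₀)) (ρ := 1 - L) (v := 1) (d := d)
    (by linarith) one_pos hd (fun h _ => by positivity)
    (fun h hh => sum_mover_unmoved_le hp fun i hi => hL h i hh hi)
    (fun h _ => expect_failure_le_one hp M h)
    (fun h hh hlt => hM h hh (unmoved_eq_empty hlt)) K (h := []) hI0
  simpa [unmoved] using h1

lemma pow_le_inv_of_log_le {r A : ℝ} (hr : r ≤ 1) (hA : 0 < A) {K : ℕ}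
    (h : Real.log A ≤ r * K) : (1 - r) ^ K ≤ 1 / A := by
  calc (1 - r) ^ K ≤ Real.exp (-r) ^ K :=
        pow_le_pow_left₀ (by linarith) (Real.one_sub_le_exp_neg r) K
    _ = Real.exp (-(r * K)) := by rw [← Real.exp_nat_mul]; ring_nf
    _ ≤ Real.exp (-Real.log A) := Real.exp_le_exp.2 (by linarith)
    _ = 1 / A := by rw [Real.exp_neg, Real.exp_log hA, one_div]

/-- The four phases together fail with probability at most `δ`. -/
lemma expect_failure_le (hn : 3 ≤ n) (hα : 0 < α) (hα' : α < 1 / 4) (hy : ∀ i, 0 ≤ y₀ i)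
    (hp : IsMoverLaw p) (hI : IsClosedUnder p I) (hI0 : I []) (hL0 : 0 < L) (hL1 : L ≤ 1)
    (hL : ∀ h i, I h → h.head? ≠ some i → L ≤ p h i) (hU : ∀ h i, I h → p h i ≤ 1 / 2)
    (hε : 0 < ε) (hε1 : ε < 1) (hδ : 0 < δ) (hδ1 : δ < 1) {T : ℕ}
    (hT : 200 * (Real.log (Real.log (1 / gamma 1 α y₀)) + 1 / L * Real.log (n / (ε * δ))) ≤ T) :
    expect p T (failure α ε y₀) [] ≤ δ := by
  have hγ : 0 < gamma 1 α y₀ := gamma_pos (by simpa using hα)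
  have hγα : gamma 1 α y₀ ≤ α := by simpa using gamma_le (c := 1) (a := α) (x₀ := y₀)
  have h3 : (3 : ℝ) ≤ n := by exact_mod_cast hn
  have hn0 : (0 : ℝ) < n := by linarith
  have hn2 : (9 : ℝ) ≤ n ^ 2 := by nlinarith
  have hεδ : 0 < ε * δ := by positivity
  have hG1 : 1 ≤ Real.log (1 / gamma 1 α y₀) := by
    rw [Real.le_log_iff_exp_le (by positivity), le_div_iff₀ hγ]
    nlinarith [Real.exp_one_lt_d9]
  set G := Real.log (1 / gamma 1 α y₀) with hG
  have hLL : 0 ≤ Real.log G := Real.log_nonneg hG1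
  have hq : 3 ≤ n / (ε * δ) := by
    rw [le_div_iff₀ hεδ]; nlinarith
  set l := Real.log (n / (ε * δ)) with hl
  have hl1 : 1 ≤ l := by
    rw [hl, Real.le_log_iff_exp_le (by linarith)]
    linarith [Real.exp_one_lt_d9]
  -- any power of `n`, even divided by `ε δ`, costs only a constant factor
  have hlog : ∀ (k : ℕ) (A : ℝ), 0 < A → 1 ≤ k → A ≤ n ^ k / (ε * δ) → Real.log A ≤ k * l := by
    intro k A hA hk hAk
    rw [hl, ← Real.log_pow]
    refine Real.log_le_log hA (hAk.trans ?_)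
    rw [div_pow]
    gcongr
    exact pow_le_of_le_one hεδ.le (by nlinarith) (by omega)
  obtain ⟨K₁, hK₁⟩ : ∃ K : ℕ, K = ⌈3 * l / L⌉₊ := ⟨_, rfl⟩
  obtain ⟨K₂, hK₂⟩ : ∃ K : ℕ, K = ⌈4 * (Real.log G + 4 * l)⌉₊ := ⟨_, rfl⟩
  obtain ⟨K₃, hK₃⟩ : ∃ K : ℕ, K = ⌈9 * l / L⌉₊ := ⟨_, rfl⟩
  obtain ⟨K₄, hK₄⟩ : ∃ K : ℕ, K = ⌈121 * l / L⌉₊ := ⟨_, rfl⟩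
  have hsum : K₁ + (K₂ + (K₃ + K₄)) ≤ T := by
    have e1 := (Nat.ceil_lt_add_one (show 0 ≤ 3 * l / L by positivity)).le
    have e2 := (Nat.ceil_lt_add_one (show 0 ≤ 4 * (Real.log G + 4 * l) by positivity)).le
    have e3 := (Nat.ceil_lt_add_one (show 0 ≤ 9 * l / L by positivity)).le
    have e4 := (Nat.ceil_lt_add_one (show 0 ≤ 121 * l / L by positivity)).le
    rw [← hK₁] at e1
    rw [← hK₂] at e2
    rw [← hK₃] at e3
    rw [← hK₄] at e4
    have hlL : l ≤ 1 / L * l := by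
      have : 1 ≤ 1 / L := by rw [le_div_iff₀ hL0]; linarith
      nlinarith
    have hdiv : ∀ r : ℝ, r * l / L = r * (1 / L * l) := fun r => by ring
    rw [hdiv] at e1 e3 e4
    have : ((K₁ + (K₂ + (K₃ + K₄)) : ℕ) : ℝ) ≤ T := by push_cast; linarith
    exact_mod_cast this
  have k1 : Real.log (4 * n / δ) ≤ L * K₁ := by
    have e := Nat.le_ceil (3 * l / L)
    rw [← hK₁, div_le_iff₀ hL0] at e
    have := hlog 3 (4 * n / δ) (by positivity) (by norm_num) (by
      apply div_le_div₀ (by positivity) (by nlinarith) hεδ (by nlinarith))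
    push_cast at this
    linarith
  have k2 : Real.log (40 * G / δ) ≤ 1 / 4 * K₂ := by
    have e := Nat.le_ceil (4 * (Real.log G + 4 * l))
    rw [← hK₂] at e
    have := hlog 4 (40 / δ) (by positivity) (by norm_num) (by
      refine div_le_div₀ (by positivity) ?_ hεδ (by nlinarith)
      have := pow_le_pow_left₀ (by norm_num) h3 4
      linarith)
    push_cast at this
    rw [show 40 * G / δ = G * (40 / δ) by ring, Real.log_mul (by linarith) (by positivity)]
    linarith
  have k3 : Real.log (4 * (3 + n) / δ) ≤ L / 3 * K₃ := by
    have e := Nat.le_ceil (9 * l / L)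
    rw [← hK₃, div_le_iff₀ hL0] at e
    have := hlog 3 (4 * (3 + n) / δ) (by positivity) (by norm_num) (by
      apply div_le_div₀ (by positivity) (by nlinarith) hεδ (by nlinarith))
    push_cast at this
    linarith
  have k4 : Real.log (1024 * n ^ 4 / (ε * δ)) ≤ L / 11 * K₄ := by
    have e := Nat.le_ceil (121 * l / L)
    rw [← hK₄, div_le_iff₀ hL0] at e
    have := hlog 11 (1024 * n ^ 4 / (ε * δ)) (by positivity) (by norm_num) (by
      gcongr
      have := pow_le_pow_left₀ (by norm_num) h3 7
      rw [show (n : ℝ) ^ 11 = n ^ 7 * n ^ 4 by ring]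
      gcongr
      linarith)
    push_cast at this
    linarith
  obtain ⟨R, rfl⟩ := Nat.exists_eq_add_of_le hsum
  rw [show K₁ + (K₂ + (K₃ + K₄)) + R = K₁ + (K₂ + (K₃ + (K₄ + R))) by ring]
  have f4 : (1 - L / 11) ^ K₄ * (n : ℝ) ^ 2 / (ε / (256 * (n : ℝ) ^ 2)) ≤ δ / 4 := by
    have := pow_le_inv_of_log_le (by linarith) (by positivity) k4
    calc (1 - L / 11) ^ K₄ * (n : ℝ) ^ 2 / (ε / (256 * (n : ℝ) ^ 2))
        ≤ 1 / (1024 * n ^ 4 / (ε * δ)) * (n : ℝ) ^ 2 / (ε / (256 * (n : ℝ) ^ 2)) := by gcongr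
      _ = δ / 4 := by field_simp; norm_num
  have f3 : (1 - L / 3) ^ K₃ * (3 + n) ≤ δ / 4 := by
    have := pow_le_inv_of_log_le (by linarith) (by positivity) k3
    calc (1 - L / 3) ^ K₃ * (3 + n) ≤ 1 / (4 * (3 + n) / δ) * (3 + n) := by gcongr
      _ = δ / 4 := by field_simp
  have f2 : (3 / 4) ^ K₂ * G / (1 / 10) ≤ δ / 4 := by
    have := pow_le_inv_of_log_le (r := 1 / 4) (by norm_num) (by positivity) k2
    rw [show (1 : ℝ) - 1 / 4 = 3 / 4 by norm_num] at this
    calc (3 / 4) ^ K₂ * G / (1 / 10) ≤ 1 / (40 * G / δ) * G / (1 / 10) := by gcongr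
      _ = δ / 4 := by field_simp; norm_num
  have f1 : (1 - L) ^ K₁ * n ≤ δ / 4 := by
    have := pow_le_inv_of_log_le hL1 (by positivity) k1
    calc (1 - L) ^ K₁ * n ≤ 1 / (4 * n / δ) * n := by gcongr
      _ = δ / 4 := by field_simp
  have g4 : ∀ h, I h → (∀ i, i ∈ h) → Tame 0 (profileAfter 1 α y₀ h) →
      expect p (K₄ + R) (failure α ε y₀) h ≤ δ / 4 := fun h hh hall ht =>
    (expect_failure_of_tame hn hα hα' hy hp hI hL0.le hL1 hL hε hε1 K₄ R hh hall ht).trans f4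
  have g3 : ∀ h, I h → (∀ i, i ∈ h) → 9 / 20 ≤ ∑ i, profileAfter 1 α y₀ h i →
      expect p (K₃ + (K₄ + R)) (failure α ε y₀) h ≤ δ / 2 := fun h hh hall hs => by
    have := expect_failure_of_total_ge hn hα hα' hy hp hI hL0.le hL1 hL (by positivity) g4 K₃
      hh hall hs
    linarith
  have g2 : ∀ h, I h → (∀ i, i ∈ h) →
      expect p (K₂ + (K₃ + (K₄ + R))) (failure α ε y₀) h ≤ 3 * δ / 4 := fun h hh hall => by
    have := expect_failure_of_all_moved hn hα hα' hy hp hI hU (by positivity) g3 K₂ hh hall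
    linarith
  have := expect_failure_nil hp hI hI0 hL1 hL (by positivity) g2 K₁
  linarith

end Upper

section UpperBound

variable {n : ℕ} {c a L U ε δ : ℝ} {x₀ : Fin n → ℝ} {w : SelectionRule n}

lemma failure_smul (hc : 0 < c) : failure (c * a) ε (fun i => c * x₀ i) =
    fun h => 1 - (open Classical in if h ∈ {h | Reaches c a ε x₀ h} then (1 : ℝ) else 0) := by
  funext h
  by_cases H : Reaches c a ε x₀ h
  · simp [failure, (reaches_smul hc x₀ h).2 H, H]
  · simp [failure, mt (reaches_smul hc x₀ h).1 H, H]

lemma probReached_eq (hc : 0 < c) (T : ℕ) : probReached c a ε w x₀ T =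
    1 - expect (moverProb c a w x₀) T (failure (c * a) ε fun i => c * x₀ i) [] := by
  have hp := isMoverLaw_moverProb c a w x₀
  rw [probReached, toReal_historyLaw, failure_smul hc]
  have h1 := expect_add_fun (p := moverProb c a w x₀) T
    (fun h => 1 - (open Classical in if h ∈ {h | Reaches c a ε x₀ h} then (1 : ℝ) else 0))
    (fun h => open Classical in if h ∈ {h | Reaches c a ε x₀ h} then (1 : ℝ) else 0) []
  simp only [sub_add_cancel] at h1
  rw [expect_const hp] at h1
  linarith

lemma probNotReached_eq (hc : 0 < c) (T : ℕ) : probNotReached c a ε w x₀ T =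
    expect (moverProb c a w x₀) T (failure (c * a) ε fun i => c * x₀ i) [] := by
  rw [probNotReached, toReal_historyLaw]
  congr 1
  funext h
  by_cases H : Reaches c a ε x₀ h
  · simp [failure, (reaches_smul hc x₀ h).2 H, H]
  · simp [failure, mt (reaches_smul hc x₀ h).1 H, H]

theorem probReached_ge (hn : 3 ≤ n) (hc : 0 < c) (ha : 0 < a) (hca : c * a < 1 / 4)
    (hL : 0 < L) (hU : U < 1 / 2) (hx : ∀ i, 0 ≤ x₀ i)
    (hw : IsAdmissible c a L U w x₀) (hε : 0 < ε) (hε1 : ε < 1) (hδ : 0 < δ) (hδ1 : δ < 1)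
    (hLU : L ≤ U) {T : ℕ}
    (hT : 200 * (1 / (1 - 2 * U) * Real.log (Real.log (1 / gamma c a x₀))
            + 1 / (L * (1 - 2 * U)) * Real.log (n / (ε * δ))
            + 1 / (1 - 2 * U) ^ 2 * Real.log (1 / δ)) ≤ (T : ℝ)) :
    1 - δ ≤ probReached c a ε w x₀ T := by
  have hγ : 0 < gamma c a x₀ := gamma_pos (by positivity)
  have hγα : gamma c a x₀ ≤ c * a := gamma_le
  have h3 : (3 : ℝ) ≤ n := by exact_mod_cast hn
  have hLL : 0 ≤ Real.log (Real.log (1 / gamma c a x₀)) := by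
    refine Real.log_nonneg ?_
    rw [Real.le_log_iff_exp_le (by positivity), le_div_iff₀ hγ]
    nlinarith [Real.exp_one_lt_d9]
  have hl : 0 ≤ Real.log (n / (ε * δ)) := by
    refine Real.log_nonneg ?_
    rw [le_div_iff₀ (by positivity)]; nlinarith
  have hlδ : 0 ≤ Real.log (1 / δ) := by
    refine Real.log_nonneg ?_
    rw [le_div_iff₀ hδ]; linarith
  have hU1 : 1 ≤ 1 / (1 - 2 * U) := by
    rw [le_div_iff₀ (by linarith)]; linarith
  have t1 : Real.log (Real.log (1 / gamma c a x₀)) ≤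
      1 / (1 - 2 * U) * Real.log (Real.log (1 / gamma c a x₀)) := le_mul_of_one_le_left hLL hU1
  have t2 : 1 / L * Real.log (n / (ε * δ)) ≤ 1 / (L * (1 - 2 * U)) * Real.log (n / (ε * δ)) := by
    refine mul_le_mul_of_nonneg_right ?_ hl
    rw [← one_div_mul_one_div]
    exact le_mul_of_one_le_right (by positivity) hU1
  have t3 : 0 ≤ 1 / (1 - 2 * U) ^ 2 * Real.log (1 / δ) := by positivity
  have key := expect_failure_le (L := L) (ε := ε) (δ := δ) (T := T) (α := c * a)
    (y₀ := fun i => c * x₀ i) hn (by positivity) hca (fun i => mul_nonneg hc.le (hx i))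
    (isMoverLaw_moverProb c a w x₀) (isClosedUnder_isPossible c a w x₀)
    (isPossible_nil c a w x₀) hL (by linarith)
    (fun h i hh hi => (hw h.length h hh i).2 hi) (fun h i hh => (hw h.length h hh i).1.trans hU.le)
    hε hε1 hδ hδ1 (by rw [gamma_smul]; linarith)
  rw [probReached_eq hc]
  linarith

end UpperBound

/-! ### Profiles that are not approximate equilibria -/

section NotEquilibrium

variable {n : ℕ} {α ε : ℝ} {y₀ : Fin n → ℝ}

/-- An idle agent with room for profit rules out an approximate equilibrium. -/
lemma not_isApproxEquilibrium_of_eq_zero {x : Fin n → ℝ} (hs0 : 0 < ∑ i, x i)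
    (hs1 : ∑ i, x i < 1) {i : Fin n} (hi : x i = 0) (hε : ε < 1) :
    ¬ IsApproxEquilibrium 1 ε x := by
  intro H
  have h1 := H.le_utility (i := i) (by linarith) (by linarith)
  rw [hi, sub_zero, utility, if_neg hs0.ne', hi] at h1
  have h2 : √(∑ j, x j) < 1 := (Real.sqrt_lt' one_pos).2 (by simpa using hs1)
  have h3 : 0 < (1 - ε) * (1 - √(∑ j, x j)) ^ 2 :=
    mul_pos (by linarith) (pow_pos (by linarith) 2)
  norm_num at h1
  linarith

lemma total_mem_Ioo (hα : 0 < α) (hα' : α < 1 / 4) (hy : ∀ i, 0 ≤ y₀ i)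
    (h0 : ∑ i, y₀ i ∈ Set.Ioo (0 : ℝ) 1) (h : List (Fin n)) :
    ∑ i, profileAfter 1 α y₀ h i ∈ Set.Ioo (0 : ℝ) 1 := by
  induction h with
  | nil => exact h0
  | cons i h ih =>
    have h1 := sum_sub_nonneg (profileAfter_nonneg hα.le hy h) i
    have h2 := profileAfter_nonneg hα.le hy h i
    rw [profileAfter, sum_move]
    rcases h1.eq_or_lt with h3 | h3
    · rw [← h3, br_zero]; exact ⟨by linarith, by linarith⟩
    · have h4 : ∑ j, profileAfter 1 α y₀ h j - profileAfter 1 α y₀ h i < 1 := by linarith [ih.2]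
      rw [br_add_of_le_one h3 h4.le]
      exact ⟨Real.sqrt_pos.2 h3, (Real.sqrt_lt' one_pos).2 (by simpa using h4)⟩

/-- If no profile of the first steps is an approximate equilibrium, whoever moves, then failure
is certain. -/
lemma expect_failure_eq_one {p : List (Fin n) → Fin n → ℝ} (hp : IsMoverLaw p) (K : ℕ)
    (h : List (Fin n))
    (H : ∀ h', h'.length ≤ h.length + K → ¬ IsApproxEquilibrium 1 ε (profileAfter 1 α y₀ h')) :
    expect p K (failure α ε y₀) h = 1 := by
  induction K generalizing h with
  | zero =>
    have : ¬ Reaches 1 α ε y₀ h := fun ⟨h', hh', hx⟩ => H h' hh'.length_le hx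
    simp [expect, failure, this]
  | succ K ih =>
    rw [expect]
    rw [Finset.sum_congr rfl fun i _ => by
      rw [ih (i :: h) fun h' hh' => H h' (by rw [List.length_cons] at hh'; omega), mul_one]]
    exact hp.sum_eq_one h

end NotEquilibrium

/-! ### Coupon collection -/

section Coupons

variable {n : ℕ} {α ε : ℝ} {y₀ : Fin n → ℝ}

lemma pow_add_mul_le {a b : ℝ} (ha : 0 ≤ a) (hb : 0 ≤ b) (m : ℕ) :
    a ^ (m + 1) + (m + 1) * a ^ m * b ≤ (a + b) ^ (m + 1) := by
  induction m with
  | zero => simp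
  | succ m ih =>
    have h1 := mul_le_mul_of_nonneg_right ih (add_nonneg ha hb)
    have h2 : 0 ≤ (m + 1) * a ^ m * b * b := by positivity
    rw [pow_succ (a + b)]
    push_cast
    refine le_trans (le_of_sub_nonneg ?_) h1
    refine h2.trans (le_of_eq ?_)
    ring

lemma not_reaches_of_notMem (hα : 0 < α) (hα' : α < 1 / 4) (hy : ∀ i, 0 ≤ y₀ i)
    (h0 : ∑ i, y₀ i ∈ Set.Ioo (0 : ℝ) 1) (hε : ε < 1) {i : Fin n} (hi : y₀ i = 0)
    {h : List (Fin n)} (hih : i ∉ h) : ¬ Reaches 1 α ε y₀ h := by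
  rintro ⟨h', hh', hx⟩
  have h1 := total_mem_Ioo hα hα' hy h0 h'
  refine not_isApproxEquilibrium_of_eq_zero h1.1 h1.2 (i := i) ?_ hε hx
  rw [profileAfter_of_notMem fun h => hih (hh'.subset h), hi]

/-- If every move is made by an agent drawn independently from the same distribution, then `m`
idle agents, each of probability `r`, all move within `K` steps with probability at most
`(1 - (1 - r) ^ K) ^ m`. -/
lemma expect_failure_ge (hα : 0 < α) (hα' : α < 1 / 4) (hy : ∀ i, 0 ≤ y₀ i)
    (h0 : ∑ i, y₀ i ∈ Set.Ioo (0 : ℝ) 1) (hε : ε < 1) {p : List (Fin n) → Fin n → ℝ}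
    (hp : IsMoverLaw p) {S : Finset (Fin n)} {r : ℝ} (hr0 : 0 ≤ r) (hr1 : r ≤ 1)
    (hS : ∀ i ∈ S, y₀ i = 0) (hpS : ∀ h, ∀ i ∈ S, p h i = r) (K : ℕ) (h : List (Fin n)) :
    1 - (1 - (1 - r) ^ K) ^ (S ∩ unmoved h).card ≤ expect p K (failure α ε y₀) h := by
  induction K generalizing h with
  | zero =>
    rw [expect]
    rcases Finset.eq_empty_or_nonempty (S ∩ unmoved h) with he | ⟨i, hi⟩
    · simpa [he] using failure_nonneg h
    · rw [Finset.mem_inter] at hi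
      have := not_reaches_of_notMem hα hα' hy h0 hε (hS i hi.1) (h := h)
        (by simpa [unmoved] using hi.2)
      simp only [failure, if_neg this, pow_zero, sub_self]
      have : (0 : ℝ) ≤ 0 ^ (S ∩ unmoved h).card := by positivity
      linarith
  | succ K ih =>
    have hq0 : 0 ≤ 1 - (1 - r) ^ K := sub_nonneg.2 (pow_le_one₀ (by linarith) (by linarith))
    have hq1 : 0 ≤ (1 - r) ^ K := pow_nonneg (by linarith) K
    have hsub : ∀ i, S ∩ unmoved (i :: h) = (S ∩ unmoved h).erase i := by
      intro i; ext j; simp [unmoved]; tauto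
    set R := S ∩ unmoved h with hR
    have hq : 1 - (1 - r) ^ (K + 1) = (1 - (1 - r) ^ K) + r * (1 - r) ^ K := by ring
    rw [hq, expect]
    set q := 1 - (1 - r) ^ K with hqdef
    have hle : ∑ i, p h i * (1 - q ^ R.card - if i ∈ R then (q ^ (R.card - 1) - q ^ R.card) else 0)
        ≤ ∑ i, p h i * expect p K (failure α ε y₀) (i :: h) := by
      refine sum_mover_mono hp fun i _ => le_trans (le_of_eq ?_) (ih (i :: h))
      rw [hsub]
      split_ifs with hi
      · rw [Finset.card_erase_of_mem hi]; ring
      · rw [Finset.erase_eq_of_notMem hi, sub_zero]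
    have hsum : ∑ i, p h i *
        (1 - q ^ R.card - if i ∈ R then (q ^ (R.card - 1) - q ^ R.card) else 0) =
        1 - q ^ R.card - R.card * r * (q ^ (R.card - 1) - q ^ R.card) := by
      have h1 : ∑ i ∈ R, p h i = R.card * r := by
        rw [Finset.sum_congr rfl fun i hi => hpS h i (Finset.mem_inter.1 hi).1]
        rw [Finset.sum_const, nsmul_eq_mul]
      simp only [mul_sub, Finset.sum_sub_distrib, ← Finset.sum_mul, hp.sum_eq_one, one_mul,
        mul_ite, mul_zero, mul_one, Finset.sum_ite_mem, Finset.univ_inter, h1]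
    refine le_trans ?_ hle
    rw [hsum]
    rcases Nat.eq_zero_or_pos R.card with hm | hm
    · simp [hm]
    · obtain ⟨m, hm⟩ := Nat.exists_eq_succ_of_ne_zero hm.ne'
      have h1 := pow_add_mul_le hq0 (mul_nonneg hr0 hq1) m
      rw [hm, Nat.succ_sub_one, Nat.succ_eq_add_one]
      have h2 : (1 - r) ^ K = 1 - q := by rw [hqdef]; ring
      rw [h2] at h1 ⊢
      push_cast
      have h3 : (m + 1 : ℝ) * r * (q ^ m - q ^ (m + 1)) = (m + 1) * q ^ m * (r * (1 - q)) := by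
        ring
      linarith

/-- The bound of `expect_failure_ge` is at most `δ` for `k ≥ N φ / 3` agents of probability `r` and
up to `φ / (20 r) * log (N δ)` steps. -/
lemma coupon_pow_le {N r φ δ : ℝ} {k T : ℕ} (hr0 : 0 < r) (hr1 : r ≤ 1 / 2) (hφ0 : 0 < φ)
    (hφ1 : φ ≤ 1) (hk : 1 ≤ k) (hkN : N * φ / 3 ≤ k) (hδ0 : 0 < δ) (hN : 1 < N * δ)
    (hT : T ≤ φ / (20 * r) * Real.log (N * δ)) : (1 - (1 - r) ^ T) ^ k ≤ δ := by
  have hN0 : 0 < N := by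
    by_contra hc
    nlinarith
  have hl : 0 < Real.log (N * δ) := Real.log_pos hN
  have hexp : Real.exp (Real.log (N * δ)) = N * δ := Real.exp_log (by linarith)
  set l := Real.log (N * δ) with hldef
  have hll : l ≤ N * δ := by
    rw [← hexp]; linarith [Real.add_one_le_exp l]
  obtain ⟨y, hy⟩ : ∃ y, y = φ * l / 10 := ⟨_, rfl⟩
  have hy0 : 0 < y := by rw [hy]; positivity
  have hq0 : 0 ≤ 1 - (1 - r) ^ T := sub_nonneg.2 (pow_le_one₀ (by linarith) (by linarith))
  have hpow : Real.exp (-y) ≤ (1 - r) ^ T := by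
    have h1 : Real.exp (-(2 * r)) ≤ 1 - r := by
      rw [Real.exp_neg, inv_le_comm₀ (Real.exp_pos _) (by linarith)]
      refine le_trans ?_ (Real.add_one_le_exp (2 * r))
      rw [inv_le_iff_one_le_mul₀ (by linarith)]
      nlinarith
    have h2 : T * (2 * r) ≤ y := by
      have := mul_le_mul_of_nonneg_right hT (show 0 ≤ 2 * r by linarith)
      refine this.trans (le_of_eq ?_)
      rw [hy]; field_simp; norm_num
    calc Real.exp (-y) ≤ Real.exp (T * -(2 * r)) := Real.exp_le_exp.2 (by linarith)
      _ = Real.exp (-(2 * r)) ^ T := Real.exp_nat_mul _ _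
      _ ≤ (1 - r) ^ T := pow_le_pow_left₀ (Real.exp_pos _).le h1 T
  set q := 1 - (1 - r) ^ T with hq
  rcases le_or_gt y (Real.exp (-1)) with hy1 | hy1
  · have hqy : q ≤ y := by linarith [Real.add_one_le_exp (-y)]
    obtain ⟨m, rfl⟩ := Nat.exists_eq_add_of_le' hk
    obtain ⟨v, hv⟩ : ∃ v, v = N * φ := ⟨_, rfl⟩
    have hv0 : 0 < v := by rw [hv]; positivity
    have h1 : q ^ m ≤ Real.exp (1 - v / 3) := by
      calc q ^ m ≤ Real.exp (-1) ^ m := pow_le_pow_left₀ hq0 (hqy.trans hy1) m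
        _ = Real.exp (m * -1) := (Real.exp_nat_mul _ _).symm
        _ ≤ Real.exp (1 - v / 3) := by
          refine Real.exp_le_exp.2 ?_
          push_cast at hkN
          rw [hv]; linarith
    have h2 : v / 3 * Real.exp (1 - v / 3) ≤ 1 := by
      have h3 : v / 3 ≤ Real.exp (v / 3 - 1) := by linarith [Real.add_one_le_exp (v / 3 - 1)]
      calc v / 3 * Real.exp (1 - v / 3)
          ≤ Real.exp (v / 3 - 1) * Real.exp (1 - v / 3) := by gcongr
        _ = 1 := by rw [← Real.exp_add]; simp
    calc q ^ (m + 1) = q ^ m * q := pow_succ _ _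
      _ ≤ Real.exp (1 - v / 3) * y := mul_le_mul h1 hqy hq0 (Real.exp_pos _).le
      _ = 3 / 10 * (v / 3 * Real.exp (1 - v / 3)) * l / N := by
        rw [hy, hv]; field_simp
      _ ≤ 3 / 10 * 1 * (N * δ) / N := by gcongr
      _ ≤ δ := by field_simp; linarith
  · have h1 : q ≤ Real.exp (-Real.exp (-y)) := by
      linarith [Real.add_one_le_exp (-Real.exp (-y))]
    have h2 : 1 / δ ≤ k * Real.exp (-y) := by
      have h3 : Real.exp (-(l / 10)) ≤ Real.exp (-y) := by
        refine Real.exp_le_exp.2 ?_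
        rw [hy]; nlinarith
      have h4 : 1 ≤ 3 * y := by
        have : (1 : ℝ) / 3 ≤ Real.exp (-1) := by
          rw [Real.exp_neg, le_inv_comm₀ (by norm_num) (Real.exp_pos _)]
          linarith [Real.exp_one_lt_d9]
        linarith
      have h5 : 1 / φ ≤ 3 * l / 10 := by
        rw [div_le_iff₀ hφ0]; rw [hy] at h4; linarith
      have h6 : l ≤ 10 / 9 * Real.exp (9 / 10 * l) := by
        linarith [Real.add_one_le_exp (9 / 10 * l)]
      have h7 : Real.exp (9 / 10 * l) * Real.exp (l / 10) = N * δ := by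
        rw [← Real.exp_add, ← hexp]; ring_nf
      have h8 : 3 / φ ≤ N * δ * Real.exp (-(l / 10)) := by
        have h9 : N * δ * Real.exp (-(l / 10)) = Real.exp (9 / 10 * l) := by
          rw [← h7, mul_assoc, ← Real.exp_add]; simp
        rw [h9]
        have h10 : 3 / φ = 3 * (1 / φ) := by ring
        linarith
      rw [div_le_iff₀ hδ0]
      rw [div_le_iff₀ hφ0] at h8
      calc (1 : ℝ) ≤ N * φ / 3 * Real.exp (-(l / 10)) * δ := by linarith
        _ ≤ k * Real.exp (-y) * δ := by gcongr
    calc q ^ k ≤ Real.exp (-Real.exp (-y)) ^ k := pow_le_pow_left₀ hq0 h1 k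
      _ = Real.exp (-(k * Real.exp (-y))) := by rw [← Real.exp_nat_mul]; ring_nf
      _ ≤ Real.exp (-(1 / δ)) := Real.exp_le_exp.2 (by linarith)
      _ ≤ δ := by
        rw [Real.exp_neg, inv_le_comm₀ (Real.exp_pos _) hδ0]
        have := Real.add_one_le_exp (1 / δ)
        rw [one_div] at this ⊢
        linarith

end Coupons

/-! ### Limits to the speed of convergence -/

section Convergence

variable {n : ℕ} {α ε : ℝ} {y₀ : Fin n → ℝ}

/-- A move cannot cancel the distance to the equilibrium. If all other outputs are within `η` of
the equilibrium before the move of `j`, then the last mover `i` best responded to the others,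
whence their total is nearly in equilibrium too, and so is the output of `j`. -/
lemma abs_sub_lt_of_last (hn : 3 ≤ n) {x : Fin n → ℝ} (hx : ∀ k, 0 ≤ x k)
    (hs1 : ∑ k, x k < 1) {i j : Fin n} (hij : j ≠ i)
    (hbr : x i = br α (∑ k, x k - x i)) {e η : ℝ} (he : e = (n - 1) / (n : ℝ) ^ 2)
    (hη : η ≤ e / 10) (hother : ∀ k, k ≠ j → |x k - e| < η) : |x j - e| < 7 * n * η := by
  have h3 : (3 : ℝ) ≤ n := by exact_mod_cast hn
  have hn0 : (0 : ℝ) < n := by linarith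
  have he0 : 0 < e := by rw [he]; exact div_pos (by linarith) (by positivity)
  have hη0 : 0 < η := lt_of_le_of_lt (abs_nonneg _) (hother i hij.symm)
  set R := (Finset.univ.erase i).erase j with hR
  have hRj : ∀ k ∈ R, k ≠ j := fun k hk => Finset.ne_of_mem_erase hk
  have hcard : (R.card : ℝ) = n - 2 := by
    have h1 : R.card = n - 2 := by
      rw [hR, Finset.card_erase_of_mem (by simp [hij]), Finset.card_erase_of_mem (by simp),
        Finset.card_univ, Fintype.card_fin]
      omega
    rw [h1, Nat.cast_sub (by omega)]
    norm_num
  have hsum : ∑ k, x k - x i = x j + ∑ k ∈ R, x k := by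
    rw [← Finset.add_sum_erase _ _ (Finset.mem_univ i),
      ← Finset.add_sum_erase (Finset.univ.erase i) _ (by simp [hij] : j ∈ Finset.univ.erase i)]
    ring
  have hRup : ∑ k ∈ R, x k ≤ (n - 2) * (e + η) := by
    have := Finset.sum_le_card_nsmul R x (e + η) fun k hk => by
      linarith [(abs_lt.1 (hother k (hRj k hk))).2]
    rwa [nsmul_eq_mul, hcard] at this
  have hRlow : (n - 2) * (e - η) ≤ ∑ k ∈ R, x k := by
    have := Finset.card_nsmul_le_sum R x (e - η) fun k hk => by
      linarith [(abs_lt.1 (hother k (hRj k hk))).1]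
    rwa [nsmul_eq_mul, hcard] at this
  set Y := ∑ k, x k - x i with hY
  have hYlow : 16 / 9 / (n : ℝ) ^ 2 ≤ Y := by
    have h1 : (n - 2) * (e - e / 10) ≤ (n - 2) * (e - η) :=
      mul_le_mul_of_nonneg_left (by linarith) (by linarith)
    have h2 : 16 / 9 / (n : ℝ) ^ 2 ≤ (n - 2) * (e - e / 10) := by
      rw [he, show ((n : ℝ) - 2) * ((n - 1) / (n : ℝ) ^ 2 - (n - 1) / (n : ℝ) ^ 2 / 10) =
        9 / 10 * ((n - 2) * (n - 1)) / (n : ℝ) ^ 2 by ring]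
      gcongr
      nlinarith
    linarith [hx j]
  have hY0 : 0 < Y := lt_of_lt_of_le (by positivity) hYlow
  have hY1 : Y < 1 := by linarith [hx i]
  have hr2 := Real.sq_sqrt hY0.le
  have hr1 : √Y < 1 := (Real.sqrt_lt' one_pos).2 (by simpa using hY1)
  have hrlow : 4 / 3 * (1 / n) ≤ √Y := by
    refine Real.le_sqrt_of_sq_le (le_trans (le_of_eq ?_) hYlow)
    ring
  have hxi := br_of_le_one (α := α) hY0 hY1.le
  have hi := hother i hij.symm
  rw [hbr, hxi] at hi
  set r := √Y
  obtain ⟨m, hm⟩ : ∃ m : ℝ, m = 1 / n := ⟨_, rfl⟩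
  have hmn : m * n = 1 := by rw [hm]; field_simp
  have hm0 : 0 < m := by rw [hm]; positivity
  have hem : e = (1 - m) - (1 - m) ^ 2 := by
    rw [he, hm]; field_simp; ring
  have hem' : (n - 1) * e = (1 - m) ^ 2 := by
    rw [he, hm]; field_simp
  rw [← hm] at hrlow
  have hfac : |r - (1 - m)| * |r - m| < η := by
    rw [← abs_mul]
    have : (r - (1 - m)) * (r - m) = -(r - Y - e) := by rw [← hr2, hem]; ring
    rwa [this, abs_neg]
  have hrm : m / 3 ≤ |r - m| := le_trans (by linarith) (le_abs_self _)
  have hd : |r - (1 - m)| < 3 * n * η := by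
    have h1 : |r - (1 - m)| * (m / 3) < η :=
      lt_of_le_of_lt (mul_le_mul_of_nonneg_left hrm (abs_nonneg _)) hfac
    have h2 := mul_lt_mul_of_pos_right h1 (show (0 : ℝ) < 3 * n by positivity)
    have h3 : |r - (1 - m)| * (m / 3) * (3 * n) = |r - (1 - m)| * (m * n) := by ring
    rw [h3, hmn] at h2
    linarith
  have hYd : |Y - (1 - m) ^ 2| ≤ 2 * |r - (1 - m)| := by
    have h1 : Y - (1 - m) ^ 2 = (r + (1 - m)) * (r - (1 - m)) := by rw [← hr2]; ring
    rw [h1, abs_mul]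
    refine mul_le_mul_of_nonneg_right ?_ (abs_nonneg _)
    have hm1 : m ≤ 1 := by nlinarith
    rw [abs_of_nonneg (by linarith)]
    linarith
  have h4 := abs_le.1 hYd
  have h5 := abs_lt.1 hd
  have hnη : 0 < n * η := by positivity
  rw [abs_lt]
  constructor
  · nlinarith
  · nlinarith

/-- Along every history, the largest distance of an output to the equilibrium decreases by at
most the factor `7 n` per move. -/
lemma exists_abs_sub_ge (hn : 3 ≤ n) (hα : 0 < α) (hα' : α < 1 / 4) (hy : ∀ i, 0 ≤ y₀ i)
    (h0 : ∑ i, y₀ i ∈ Set.Ioo (0 : ℝ) 1) {e : ℝ} (he : e = (n - 1) / (n : ℝ) ^ 2)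
    (hbase : ∀ i, ∃ k, k ≠ i ∧ e / 10 ≤ |y₀ k - e|) (i : Fin n) (h : List (Fin n)) :
    ∃ k, e / 10 / (7 * n) ^ h.length ≤ |profileAfter 1 α y₀ (i :: h) k - e| := by
  have h3 : (3 : ℝ) ≤ n := by exact_mod_cast hn
  have he0 : 0 < e := by rw [he]; exact div_pos (by linarith) (by positivity)
  induction h generalizing i with
  | nil =>
    obtain ⟨k, hk, hk'⟩ := hbase i
    exact ⟨k, by simpa [profileAfter, move_of_ne _ hk] using hk'⟩
  | cons l h ih =>
    obtain ⟨k, hk⟩ := ih l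
    have hle : e / 10 / (7 * n) ^ (l :: h).length ≤ e / 10 / (7 * n) ^ h.length := by
      rw [List.length_cons]
      gcongr
      · linarith
      · omega
    by_cases hil : i = l
    · subst hil
      rw [profileAfter_cons_cons]
      exact ⟨k, hle.trans hk⟩
    by_contra! hcon
    have hother : ∀ k, k ≠ i → |profileAfter 1 α y₀ (l :: h) k - e| <
        e / 10 / (7 * n) ^ (l :: h).length := by
      intro k hki
      have := hcon k
      rwa [profileAfter.eq_2 _ _ _ i, move_of_ne _ hki] at this
    have hki : k = i := by
      by_contra hki
      linarith [hother k hki]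
    have h1 := abs_sub_lt_of_last (α := α) hn (profileAfter_nonneg hα.le hy (l :: h))
      (total_mem_Ioo hα hα' hy h0 (l :: h)).2 hil (profileAfter_cons_same y₀ l h) he ?_ hother
    · rw [← hki] at h1
      refine absurd (h1.trans_le (le_of_eq ?_)) (not_lt.2 hk)
      rw [List.length_cons, pow_succ]
      field_simp
    · exact div_le_self (by positivity) (one_le_pow₀ (by linarith))

/-- At an approximate equilibrium reached after at least one move all outputs are close to the
equilibrium. -/
lemma IsApproxEquilibrium.abs_sub_le (hn : 3 ≤ n) (hα : 0 < α) (hα' : α < 1 / 4)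
    (hy : ∀ i, 0 ≤ y₀ i) (h0 : ∑ i, y₀ i ∈ Set.Ioo (0 : ℝ) 1) (hε0 : 0 < ε) (hε : ε ≤ 1 / 100)
    {e : ℝ} (he : e = (n - 1) / (n : ℝ) ^ 2) {i : Fin n} {h : List (Fin n)}
    (H : IsApproxEquilibrium 1 ε (profileAfter 1 α y₀ (i :: h)))
    (hY : ∀ k, 0 < ∑ l, profileAfter 1 α y₀ (i :: h) l - profileAfter 1 α y₀ (i :: h) k)
    (k : Fin n) : |profileAfter 1 α y₀ (i :: h) k - e| ≤ 10 * √ε := by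
  have h3 : (3 : ℝ) ≤ n := by exact_mod_cast hn
  have hx := profileAfter_nonneg hα.le hy (i :: h)
  have hs := total_mem_Ioo hα hα' hy h0 (i :: h)
  have hlast := half_le_last hα.le hy (i := i) (h := h)
  set x := profileAfter 1 α y₀ (i :: h)
  set s := ∑ l, x l with hsdef
  have hgap : ∀ k, (s - √(s - x k)) ^ 2 ≤ ε * s := by
    intro k
    have h1 := H.gap_le (hx k) (hY k) (by linarith [hx k, hs.2])
    rw [div_le_iff₀ hs.1] at h1
    have h2 : √(s - x k) ≤ 1 := Real.sqrt_le_one.2 (by linarith [hx k, hs.2])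
    have h4 : (1 - √(s - x k)) ^ 2 ≤ 1 := by nlinarith [Real.sqrt_nonneg (s - x k)]
    refine h1.trans ?_
    have := mul_le_mul_of_nonneg_left h4 (mul_nonneg hε0.le hs.1.le)
    linarith
  -- the last mover holds at least half of a small total, which the others would respond to
  have hs4 : 1 / 4 ≤ s := by
    by_contra! hs4
    have h1 := hlast (by linarith)
    obtain ⟨j, hj⟩ : ∃ j : Fin n, j ≠ i := by
      have : Nontrivial (Fin n) := Fin.nontrivial_iff_two_le.2 (by omega)
      exact exists_ne i
    have h2 := add_le_sum hx hj
    rw [← hsdef] at h2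
    have h4 := hgap j
    obtain ⟨ρ, hρ0, hρ⟩ : ∃ ρ : ℝ, 0 ≤ ρ ∧ ρ ^ 2 = s / 2 :=
      ⟨√(s / 2), Real.sqrt_nonneg _, Real.sq_sqrt (by linarith [hs.1])⟩
    have h5 : ρ ≤ √(s - x j) := Real.le_sqrt_of_sq_le (by linarith)
    have hρ1 : ρ ≤ 9 / 25 := by nlinarith
    have h6 : 0 ≤ ρ - 2 * ρ ^ 2 := by nlinarith
    have h7 : (ρ - 2 * ρ ^ 2) ^ 2 ≤ (√(s - x j) - s) ^ 2 :=
      pow_le_pow_left₀ h6 (by linarith) 2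
    have h8 : (7 / 25 : ℝ) ^ 2 ≤ (1 - 2 * ρ) ^ 2 := pow_le_pow_left₀ (by norm_num) (by linarith) 2
    have h9 : ρ ^ 2 * (7 / 25) ^ 2 ≤ ρ ^ 2 * (1 - 2 * ρ) ^ 2 :=
      mul_le_mul_of_nonneg_left h8 (sq_nonneg ρ)
    nlinarith [hs.1]
  have hη0 := Real.sqrt_nonneg ε
  have hη2 := Real.sq_sqrt hε0.le
  set η := √ε
  have hdev : ∀ k, |s ^ 2 - s + x k| ≤ 2 * η := by
    intro k
    have h1 : |s - √(s - x k)| ≤ η := by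
      refine abs_le_of_sq_le_sq ?_ hη0
      rw [hη2]
      refine (hgap k).trans ?_
      nlinarith [hs.2]
    have h2 : √(s - x k) ≤ 1 := Real.sqrt_le_one.2 (by linarith [hx k, hs.2])
    have h4 := Real.sqrt_nonneg (s - x k)
    have h5 : s ^ 2 - s + x k = (s + √(s - x k)) * (s - √(s - x k)) := by
      linear_combination Real.sq_sqrt (hY k).le
    rw [h5, abs_mul, abs_of_nonneg (by linarith)]
    exact mul_le_mul (by linarith [hs.2]) h1 (abs_nonneg _) (by norm_num)
  obtain ⟨m, hm⟩ : ∃ m : ℝ, m = 1 / n := ⟨_, rfl⟩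
  have hm0 : 0 < m := by rw [hm]; positivity
  have hm3 : m ≤ 1 / 3 := by rw [hm]; exact one_div_le_one_div_of_le (by norm_num) h3
  have hmn : m * n = 1 := by rw [hm]; field_simp
  have hem : e = (1 - m) - (1 - m) ^ 2 := by
    rw [he, hm]; field_simp; ring
  have hstot : |s - (1 - m)| ≤ 8 * η := by
    have h1 : ∑ k, (s ^ 2 - s + x k) = n * s ^ 2 - n * s + s := by
      rw [Finset.sum_add_distrib, Finset.sum_const, Finset.card_univ, Fintype.card_fin,
        nsmul_eq_mul]
      ring
    have h2 : |n * s ^ 2 - n * s + s| ≤ n * (2 * η) := by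
      rw [← h1]
      refine (Finset.abs_sum_le_sum_abs _ _).trans ?_
      have := Finset.sum_le_card_nsmul Finset.univ (fun k => |s ^ 2 - s + x k|) (2 * η)
        fun k _ => hdev k
      rwa [Finset.card_univ, Fintype.card_fin, nsmul_eq_mul] at this
    have h4 : n * s ^ 2 - n * s + s = n * (s * (s - (1 - m))) := by
      linear_combination -s * hmn
    rw [h4, abs_mul, abs_of_nonneg (by positivity : (0 : ℝ) ≤ n), abs_mul,
      abs_of_nonneg hs.1.le] at h2
    have h5 := le_of_mul_le_mul_left h2 (by positivity)
    have h6 := mul_le_mul_of_nonneg_right hs4 (abs_nonneg (s - (1 - m)))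
    linarith
  have h1 : |(s - (1 - m)) * (m - s)| ≤ 8 * η := by
    rw [abs_mul]
    have : |m - s| ≤ 1 := abs_le.2 ⟨by linarith [hs.2], by linarith [hs.1]⟩
    exact (mul_le_of_le_one_right (abs_nonneg _) this).trans hstot
  have h2 : x k - e = (s ^ 2 - s + x k) + (s - (1 - m)) * (m - s) := by
    rw [hem]; ring
  rw [h2]
  exact (abs_add_le _ _).trans (by linarith [hdev k])

/-- Whoever moves, no `ε`-approximate equilibrium is reached within `log (log (1 / ε)) / 20`
moves. -/
lemma not_isApproxEquilibrium_of_length_lt (hn : 3 ≤ n) (hα : 0 < α) (hα' : α < 1 / 4)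
    (hy : ∀ i, 0 ≤ y₀ i) (h0 : ∑ i, y₀ i ∈ Set.Ioo (0 : ℝ) 1)
    (hbase : ∀ i, ∃ k, k ≠ i ∧ ((n : ℝ) - 1) / (n : ℝ) ^ 2 / 10 ≤
      |y₀ k - ((n : ℝ) - 1) / (n : ℝ) ^ 2|)
    (hidle : ∀ i : Fin n, 2 ≤ i.val → y₀ i = 0) (hε : 0 < ε) (hε1 : ε < 1) {h : List (Fin n)}
    (hlen : h.length < 1 / 20 * Real.log (Real.log (1 / ε))) :
    ¬ IsApproxEquilibrium 1 ε (profileAfter 1 α y₀ h) := by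
  have h3 : (3 : ℝ) ≤ n := by exact_mod_cast hn
  have hs := total_mem_Ioo hα hα' hy h0
  intro H
  have hmoved : ∀ i : Fin n, 2 ≤ i.val → i ∈ h := by
    intro i hi
    by_contra hih
    refine not_isApproxEquilibrium_of_eq_zero (hs h).1 (hs h).2 (i := i) ?_ hε1 H
    rw [profileAfter_of_notMem hih, hidle i hi]
  obtain _ | ⟨i, h⟩ := h
  · exact absurd (hmoved ⟨2, by omega⟩ le_rfl) (by simp)
  -- all but two agents have moved, so that `n` is bounded by the number of moves
  have hnT : n ≤ (i :: h).length + 2 := by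
    have h1 : (Finset.univ.erase (⟨0, by omega⟩ : Fin n)).erase ⟨1, by omega⟩ ⊆
        (i :: h).toFinset := by
      intro j hj
      rw [List.mem_toFinset]
      refine hmoved j ?_
      have h5 := Finset.ne_of_mem_erase hj
      have h6 := Finset.ne_of_mem_erase (Finset.mem_of_mem_erase hj)
      rw [Ne, Fin.ext_iff] at h5 h6
      simp only [] at h5 h6
      omega
    have h2 := (Finset.card_le_card h1).trans (List.toFinset_card_le _)
    rw [Finset.card_erase_of_mem (by simp), Finset.card_erase_of_mem (by simp),
      Finset.card_univ, Fintype.card_fin] at h2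
    omega
  have hY : ∀ k, 0 < ∑ l, profileAfter 1 α y₀ (i :: h) l - profileAfter 1 α y₀ (i :: h) k := by
    intro k
    have hz : ∀ l, profileAfter 1 α y₀ (i :: h) l ≠ 0 := fun l hl =>
      not_isApproxEquilibrium_of_eq_zero (hs _).1 (hs _).2 hl hε1 H
    have hx := profileAfter_nonneg hα.le hy (i :: h)
    obtain ⟨l, hl⟩ : ∃ l : Fin n, l ≠ k := by
      have : Nontrivial (Fin n) := Fin.nontrivial_iff_two_le.2 (by omega)
      exact exists_ne k
    have h1 := add_le_sum hx hl
    have h2 := lt_of_le_of_ne (hx l) (hz l).symm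
    linarith
  obtain ⟨t, ht⟩ : ∃ t : ℝ, t = (i :: h).length := ⟨_, rfl⟩
  have ht1 : 1 ≤ t := by
    rw [ht, List.length_cons]; push_cast; linarith [h.length.cast_nonneg (α := ℝ)]
  have hE0 : 0 < Real.log (Real.log (1 / ε)) := by
    rw [← ht] at hlen; linarith
  have hl0 : 0 < Real.log (1 / ε) := Real.log_pos (by rw [lt_div_iff₀ hε]; linarith)
  have hbig : Real.exp (20 * t) ≤ Real.log (1 / ε) := by
    rw [← Real.le_log_iff_exp_le hl0, ht]; linarith
  have hbig2 : 1 + 20 * t + (20 * t) ^ 2 / 2 ≤ Real.log (1 / ε) :=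
    (Real.quadratic_le_exp_of_nonneg (by linarith)).trans hbig
  have hεexp : ε = Real.exp (-Real.log (1 / ε)) := by
    rw [one_div, Real.log_inv, neg_neg, Real.exp_log hε]
  have hεle : ε ≤ 1 / 100 := by
    rw [hεexp, Real.exp_neg, inv_le_comm₀ (Real.exp_pos _) (by norm_num)]
    have := Real.add_one_le_exp (Real.log (1 / ε))
    rw [show ((1 : ℝ) / 100)⁻¹ = 100 by norm_num]
    nlinarith
  obtain ⟨k, hk⟩ := exists_abs_sub_ge hn hα hα' hy h0 rfl hbase i h
  have hk' := hk.trans (H.abs_sub_le hn hα hα' hy h0 hε hεle rfl hY k)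
  have hsqrt : √ε = Real.exp (-(Real.log (1 / ε) / 2)) := by
    rw [Real.sqrt_eq_iff_mul_self_eq hε.le (Real.exp_pos _).le, ← Real.exp_add]
    rw [← neg_add, add_halves, ← hεexp]
  have hn7 : 7 * (n : ℝ) ≤ Real.exp (21 * t) := by
    have h1 : (n : ℝ) ≤ t + 2 := by rw [ht]; exact_mod_cast hnT
    linarith [Real.add_one_le_exp (21 * t)]
  have hlow : Real.exp (-(21 * t * t)) ≤ ((n : ℝ) - 1) / (n : ℝ) ^ 2 / (7 * n) ^ h.length := by
    have h1 : 1 / (7 * n) ≤ ((n : ℝ) - 1) / (n : ℝ) ^ 2 := by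
      rw [div_le_div_iff₀ (by positivity) (by positivity)]
      nlinarith
    calc Real.exp (-(21 * t * t)) = 1 / Real.exp (21 * t) ^ (h.length + 1) := by
          rw [← Real.exp_nat_mul, one_div, ← Real.exp_neg, ht, List.length_cons]
          push_cast; ring_nf
      _ ≤ 1 / (7 * n) ^ (h.length + 1) := by gcongr
      _ = 1 / (7 * n) / (7 * n) ^ h.length := by rw [pow_succ, div_div]; ring_nf
      _ ≤ _ := by gcongr
  have h100 : (100 : ℝ) < Real.exp (20 * t) := by
    refine lt_of_lt_of_le ?_ (Real.quadratic_le_exp_of_nonneg (by linarith))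
    nlinarith
  have hcontra : Real.exp (-(21 * t * t)) <
      Real.exp (20 * t) * Real.exp (-(21 * t * t) - 20 * t) := by
    calc Real.exp (-(21 * t * t)) ≤ 100 * √ε := by
          have h1 : ((n : ℝ) - 1) / (n : ℝ) ^ 2 / 10 / (7 * n) ^ h.length =
            ((n : ℝ) - 1) / (n : ℝ) ^ 2 / (7 * n) ^ h.length / 10 := by ring
          rw [h1] at hk'
          linarith
      _ < Real.exp (20 * t) * √ε := by
          have : 0 < √ε := Real.sqrt_pos.2 hε
          gcongr
      _ ≤ Real.exp (20 * t) * Real.exp (-(21 * t * t) - 20 * t) := by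
          gcongr
          rw [hsqrt]
          refine Real.exp_le_exp.2 ?_
          nlinarith
  rw [← Real.exp_add] at hcontra
  simp at hcontra

end Convergence

/-! ### Limits to the growth of a small total output -/

section SlowGrowth

variable {n : ℕ} {α ε : ℝ} {y₀ : Fin n → ℝ}

/-- If nobody's competitors are all idle at the start, this remains so. -/
lemma others_pos (hα : 0 < α) (hα' : α < 1 / 4) (hy : ∀ i, 0 ≤ y₀ i)
    (h0 : ∑ i, y₀ i ∈ Set.Ioo (0 : ℝ) 1) (hY : ∀ k, 0 < ∑ l, y₀ l - y₀ k) (h : List (Fin n))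
    (k : Fin n) : 0 < ∑ l, profileAfter 1 α y₀ h l - profileAfter 1 α y₀ h k := by
  induction h generalizing k with
  | nil => exact hY k
  | cons i h ih =>
    by_cases hk : k = i
    · subst hk; rw [profileAfter, sum_move_sub]; exact ih k
    · have h1 := add_le_sum (profileAfter_nonneg hα.le hy (i :: h)) hk
      have hi : 0 < profileAfter 1 α y₀ (i :: h) i := by
        have h2 := ih i
        have h3 := (total_mem_Ioo hα hα' hy h0 h).2
        have h4 := profileAfter_nonneg hα.le hy h i
        rw [profileAfter, move_one_same, br_of_le_one h2 (by linarith), sub_pos]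
        exact Real.lt_sqrt_of_sq_lt (by nlinarith)
      linarith

/-- The logarithm of a small total output at most halves with each move. -/
lemma log_total_le (hα : 0 < α) (hα' : α < 1 / 4) (hy : ∀ i, 0 ≤ y₀ i)
    (h0 : ∑ i, y₀ i ∈ Set.Ioo (0 : ℝ) 1) (hY : ∀ k, 0 < ∑ l, y₀ l - y₀ k) (h : List (Fin n)) :
    Real.log (∑ l, profileAfter 1 α y₀ h l) ≤ Real.log (∑ l, y₀ l) / 2 ^ h.length := by
  induction h with
  | nil => simp [profileAfter]
  | cons i h ih =>
    have h2 := others_pos hα hα' hy h0 hY h i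
    have h3 := total_mem_Ioo hα hα' hy h0 h
    have h4 := profileAfter_nonneg hα.le hy h i
    rw [profileAfter, sum_move, br_add_of_le_one h2 (by linarith [h3.2]), Real.log_sqrt h2.le,
      List.length_cons, pow_succ, ← div_div]
    have := Real.log_le_log h2 (show _ ≤ ∑ l, profileAfter 1 α y₀ h l by linarith)
    linarith

/-- Whoever moves, the total output stays so small during the first `log (log (1 / g)) / 20` moves
that everybody but the last mover gets next to nothing. -/
lemma not_isApproxEquilibrium_of_small (hn : 3 ≤ n) (hα : 0 < α) (hα' : α < 1 / 4)
    (hy : ∀ i, 0 ≤ y₀ i) (h0 : ∑ i, y₀ i ∈ Set.Ioo (0 : ℝ) 1) (hY : ∀ k, 0 < ∑ l, y₀ l - y₀ k)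
    {g : ℝ} (hg : 0 < g) (hg1 : g < 1 / 4) (hsum : ∑ i, y₀ i ≤ 2 * g) (hε : 0 < ε) (hε1 : ε < 1)
    {i : Fin n} {h : List (Fin n)}
    (hlen : (i :: h).length < 1 / 20 * Real.log (Real.log (1 / g)))
    (hpos : 0 < Real.log (Real.log (1 / ε)) + Real.log (Real.log (1 / g))) :
    ¬ IsApproxEquilibrium 1 ε (profileAfter 1 α y₀ (i :: h)) := by
  intro H
  have hx := profileAfter_nonneg hα.le hy (i :: h)
  have hs := total_mem_Ioo hα hα' hy h0 (i :: h)
  have hYp := others_pos hα hα' hy h0 hY (i :: h)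
  have hlog := log_total_le hα hα' hy h0 hY (i :: h)
  have hbr := profileAfter_cons_same (α := α) y₀ i h
  set x := profileAfter 1 α y₀ (i :: h)
  set s := ∑ l, x l with hsdef
  obtain ⟨t, ht⟩ : ∃ t : ℕ, t = (i :: h).length := ⟨_, rfl⟩
  rw [← ht] at hlen hlog
  have ht1 : (1 : ℝ) ≤ t := by
    rw [ht, List.length_cons]; push_cast; linarith [h.length.cast_nonneg (α := ℝ)]
  have hl0 : 0 < Real.log (1 / g) := Real.log_pos (by rw [lt_div_iff₀ hg]; linarith)
  set G := Real.log (Real.log (1 / g)) with hG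
  have hG20 : 20 < G := by linarith
  have hGexp : Real.log (1 / g) = Real.exp G := (Real.exp_log hl0).symm
  have hlogsum : Real.log (∑ l, y₀ l) ≤ -(Real.exp G / 2) := by
    have h1 : Real.log (∑ l, y₀ l) ≤ Real.log (2 * g) := Real.log_le_log h0.1 hsum
    have h2 : Real.log (2 * g) = Real.log 2 - Real.exp G := by
      rw [Real.log_mul (by norm_num) hg.ne', ← hGexp, one_div, Real.log_inv]; ring
    have h3 := Real.add_one_le_exp G
    linarith [Real.log_two_lt_d9]
  have hpow : (2 : ℝ) ^ t ≤ Real.exp (G / 4) := by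
    calc (2 : ℝ) ^ t ≤ Real.exp 1 ^ t := by
          gcongr
          linarith [Real.exp_one_gt_d9]
      _ = Real.exp (t * 1) := (Real.exp_nat_mul _ _).symm
      _ ≤ Real.exp (G / 4) := Real.exp_le_exp.2 (by linarith)
  have hlogs : Real.log s ≤ -(G + 10) := by
    have h1 : Real.exp (3 * G / 4) / 2 ≤ Real.exp G / 2 / 2 ^ t := by
      rw [le_div_iff₀ (by positivity)]
      calc Real.exp (3 * G / 4) / 2 * 2 ^ t ≤ Real.exp (3 * G / 4) / 2 * Real.exp (G / 4) := by
            gcongr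
        _ = Real.exp G / 2 := by
            rw [div_mul_eq_mul_div, ← Real.exp_add]; ring_nf
    have h2 := Real.quadratic_le_exp_of_nonneg (show 0 ≤ 3 * G / 4 by linarith)
    have h3 : Real.log (∑ l, y₀ l) / 2 ^ t ≤ -(Real.exp G / 2) / 2 ^ t := by gcongr
    rw [neg_div] at h3
    nlinarith
  have hsle : s ≤ Real.exp (-G) / 16 := by
    rw [← Real.exp_log hs.1]
    refine (Real.exp_le_exp.2 hlogs).trans ?_
    rw [neg_add, Real.exp_add, div_eq_mul_inv]
    gcongr
    rw [Real.exp_neg]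
    gcongr
    linarith [Real.quadratic_le_exp_of_nonneg (show (0 : ℝ) ≤ 10 by norm_num)]
  have hG1 : Real.exp (-G) ≤ 1 := Real.exp_le_one_iff.2 (by linarith)
  obtain ⟨j, hj⟩ : ∃ j : Fin n, j ≠ i := by
    have : Nontrivial (Fin n) := Fin.nontrivial_iff_two_le.2 (by omega)
    exact exists_ne i
  have hxj : x j ≤ s ^ 2 := by
    have h1 := br_of_le_one (α := α) (hYp i) (by linarith [hx i, hs.2])
    have h2 : s = √(s - x i) := by linarith
    have h4 := Real.sq_sqrt (hYp i).le
    rw [← h2] at h4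
    have h5 := add_le_sum hx hj
    linarith
  have hu : utility 1 x j ≤ s := by
    rw [utility, if_neg hs.1.ne']
    have : x j / s ≤ s := by
      rw [div_le_iff₀ hs.1]; linarith
    linarith [hx j]
  have hmax := H.le_utility (hYp j) (by linarith [hx j, hs.2])
  have hε2 : 1 - ε ≤ 2 * s := by
    have h1 : √(s - x j) ≤ 1 / 4 := by
      rw [Real.sqrt_le_left (by norm_num)]
      linarith [hx j]
    have h2 : 1 / 2 ≤ (1 - √(s - x j)) ^ 2 := by nlinarith
    have h4 := mul_le_mul_of_nonneg_left h2 (show 0 ≤ 1 - ε by linarith)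
    linarith
  have hE : Real.exp (-G) < Real.log (1 / ε) := by
    have hl : 0 < Real.log (1 / ε) := Real.log_pos (by rw [lt_div_iff₀ hε]; linarith)
    rw [← Real.exp_log hl]
    exact Real.exp_lt_exp.2 (by linarith)
  have hle : Real.log (1 / ε) ≤ 1 / ε - 1 := Real.log_le_sub_one_of_pos (by positivity)
  have hinv : 1 / ε - 1 ≤ 4 * s := by
    rw [sub_le_iff_le_add, div_le_iff₀ hε]
    nlinarith
  linarith [Real.exp_pos (-G)]

end SlowGrowth

/-! ### The lower bound -/

section WorstCase

variable {n : ℕ}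

/-- The initial profile of the lower bound, at unit cost: output `g` of the first agent, and of the
second agent too if `g < 1/9`; all others are idle. For small `g` the second agent keeps the first
from escaping to the output `α` as a monopolist; for large `g` two agents with this output might
be in equilibrium after one move. -/
def slowProfile (n : ℕ) (g : ℝ) : Fin n → ℝ := fun i =>
  if i.val = 0 then g else if i.val = 1 then (if g < 1 / 9 then g else 0) else 0

variable {g α : ℝ}

lemma slowProfile_nonneg (hg : 0 < g) (i : Fin n) : 0 ≤ slowProfile n g i := by
  unfold slowProfile; split_ifs <;> linarith

lemma slowProfile_of_two_le {i : Fin n} (hi : 2 ≤ i.val) : slowProfile n g i = 0 := by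
  rw [slowProfile, if_neg (by omega), if_neg (by omega)]

lemma sum_slowProfile (hn : 3 ≤ n) :
    ∑ i, slowProfile n g i = g + if g < 1 / 9 then g else 0 := by
  rw [Fintype.sum_eq_add (⟨0, by omega⟩ : Fin n) ⟨1, by omega⟩ (by simp)]
  · simp [slowProfile]
  · rintro i ⟨h0, h1⟩
    rw [Ne, Fin.ext_iff] at h0 h1
    exact slowProfile_of_two_le (by simp only [] at h0 h1; omega)

lemma gamma_slowProfile (hn : 3 ≤ n) (hg : 0 < g) (hgα : g ≤ α) (hα' : α < 1 / 4) :
    gamma 1 α (slowProfile n g) = g := by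
  have hval : ∀ y ∈ interiorOutputs 1 (slowProfile n g), y = g := by
    rintro y ⟨⟨i, rfl⟩, h0, -⟩
    rw [one_mul] at h0 ⊢
    unfold slowProfile at h0 ⊢
    split_ifs at h0 ⊢ <;> first | rfl | exact absurd h0 (lt_irrefl 0)
  apply le_antisymm
  · have := gamma_le_of_interior (c := 1) (a := α) (x₀ := slowProfile n g) (i := ⟨0, by omega⟩)
      (by simpa [slowProfile] using hg) (by simp [slowProfile]; linarith)
    simpa [slowProfile] using this
  · refine le_csInf ⟨1 * α, by simp⟩ ?_
    rintro y ((hy | ⟨z, hz, rfl⟩) | hy)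
    · exact (hval y hy).ge
    · rw [hval z hz]
      have h1 : √g ≤ 1 / 2 := (Real.sqrt_le_left (by norm_num)).2 (by linarith)
      exact Real.le_sqrt_of_sq_le (by nlinarith)
    · rw [Set.mem_singleton_iff] at hy
      rw [hy, one_mul]; exact hgα

/-- No single move makes all outputs of `slowProfile` close to the equilibrium. -/
lemma slowProfile_far (hn : 3 ≤ n) (hg : 0 < g) (i : Fin n) :
    ∃ k, k ≠ i ∧ ((n : ℝ) - 1) / (n : ℝ) ^ 2 / 10 ≤
      |slowProfile n g k - ((n : ℝ) - 1) / (n : ℝ) ^ 2| := by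
  have h3 : (3 : ℝ) ≤ n := by exact_mod_cast hn
  have he0 : 0 < ((n : ℝ) - 1) / (n : ℝ) ^ 2 := div_pos (by linarith) (by positivity)
  have hzero : ∀ k, slowProfile n g k = 0 → ((n : ℝ) - 1) / (n : ℝ) ^ 2 / 10 ≤
      |slowProfile n g k - ((n : ℝ) - 1) / (n : ℝ) ^ 2| := by
    intro k hk
    rw [hk, zero_sub, abs_neg, abs_of_pos he0]
    linarith
  have hfin : ∀ (j : ℕ) (hj : j < n), j ≠ i.val → (⟨j, hj⟩ : Fin n) ≠ i := fun j hj hji h =>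
    hji (by rw [← h])
  by_cases hi : i.val = 2
  · by_cases hg9 : g < 1 / 9
    · by_cases hn3 : n = 3
      · refine ⟨⟨0, by omega⟩, hfin _ _ (by omega), ?_⟩
        subst hn3
        have : slowProfile 3 g ⟨0, by omega⟩ = g := by simp [slowProfile]
        rw [this, abs_sub_comm]
        refine le_trans ?_ (le_abs_self _)
        norm_num
        linarith
      · exact ⟨⟨3, by omega⟩, hfin _ _ (by omega), hzero _ (slowProfile_of_two_le (by simp))⟩
    · exact ⟨⟨1, by omega⟩, hfin _ _ (by omega), hzero _ (by
        rw [slowProfile, if_neg (by simp), if_pos rfl, if_neg hg9])⟩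
  · exact ⟨⟨2, by omega⟩, hfin _ _ (by omega), hzero _ (slowProfile_of_two_le (by simp))⟩

/-- A distribution that gives the agents of `S` probability `r` each and the others equal
probabilities. -/
lemma exists_two_level (hn : 3 ≤ n) {L U r : ℝ} {k : ℕ} (hk : k ≤ n - 2) (hLr : L ≤ r)
    (hrU : r ≤ U) (h1 : 1 - k * r ≤ (n - k) * U) (h2 : (n - k) * L ≤ 1 - k * r) :
    ∃ (ν : Fin n → ℝ) (S : Finset (Fin n)), (∀ i, L ≤ ν i ∧ ν i ≤ U) ∧ ∑ i, ν i = 1 ∧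
      (∀ i ∈ S, 2 ≤ i.val ∧ ν i = r) ∧ S.card = k := by
  classical
  obtain ⟨S, hS, hSk⟩ := Finset.exists_subset_card_eq
    (s := (Finset.univ.erase (⟨0, by omega⟩ : Fin n)).erase ⟨1, by omega⟩) (n := k) (by
      rw [Finset.card_erase_of_mem (by simp), Finset.card_erase_of_mem (by simp),
        Finset.card_univ, Fintype.card_fin]
      omega)
  have hkn : 0 < (n : ℝ) - k := by
    have : (k : ℝ) < n := by exact_mod_cast (by omega : k < n)
    linarith
  refine ⟨fun i => if i ∈ S then r else (1 - k * r) / (n - k), S, fun i => ?_, ?_, fun i hi => ?_,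
    hSk⟩
  · dsimp only
    split_ifs
    · exact ⟨hLr, hrU⟩
    · rw [le_div_iff₀ hkn, div_le_iff₀ hkn]
      exact ⟨by linarith, by linarith⟩
  · rw [Finset.sum_ite, Finset.sum_const, Finset.sum_const, Finset.filter_mem_eq_inter,
      Finset.univ_inter, Finset.filter_not, Finset.filter_mem_eq_inter, Finset.univ_inter,
      Finset.card_sdiff_of_subset (Finset.subset_univ S), Finset.card_univ, Fintype.card_fin, hSk,
      nsmul_eq_mul, nsmul_eq_mul, Nat.cast_sub (by omega)]
    field_simp
    ring
  · refine ⟨?_, if_pos hi⟩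
    have h5 := Finset.ne_of_mem_erase (hS hi)
    have h6 := Finset.ne_of_mem_erase (Finset.mem_of_mem_erase (hS hi))
    rw [Ne, Fin.ext_iff] at h5 h6
    simp only [] at h5 h6
    omega

/-- A distribution of the mover for which it takes long until all initially idle agents have moved:
the uniform one, or one with as many agents of probability `L` as the upper bound `U` for
the others permits. -/
lemma exists_slow_distribution (hn : 3 ≤ n) {L U : ℝ} (hL : 0 < L) (hLn : L ≤ 1 / n)
    (hnU : 1 / n ≤ U) (hU : U < 1 / 2) (hLU : 1 ≤ L + (n - 1) * U) :
    ∃ (ν : Fin n → ℝ) (S : Finset (Fin n)) (r φ : ℝ), (∀ i, L ≤ ν i ∧ ν i ≤ U) ∧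
      ∑ i, ν i = 1 ∧ (∀ i ∈ S, 2 ≤ i.val ∧ ν i = r) ∧ 0 < r ∧ r ≤ 1 / 2 ∧ 0 < φ ∧ φ ≤ 1 ∧
      1 ≤ S.card ∧ n * φ / 3 ≤ S.card ∧ n + 1 / L * (1 - 1 / (n * U)) ≤ 2 * (φ / r) := by
  have h3 : (3 : ℝ) ≤ n := by exact_mod_cast hn
  have hn0 : (0 : ℝ) < n := by linarith
  have hU0 : 0 < U := lt_of_lt_of_le (by positivity) hnU
  have hLn' : L * n ≤ 1 := by rwa [le_div_iff₀ hn0] at hLn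
  have hnU' : 1 ≤ U * n := by rwa [div_le_iff₀ hn0] at hnU
  obtain ⟨φ, hφ⟩ : ∃ φ : ℝ, φ = 1 - 1 / (n * U) := ⟨_, rfl⟩
  have hφ1 : φ ≤ 1 := by
    rw [hφ]; linarith [show 0 < 1 / (n * U) by positivity]
  have hnφ : n * φ = n - 1 / U := by rw [hφ]; field_simp
  rw [← hφ]
  rcases le_or_gt (1 / L * φ) n with hcase | hcase
  · obtain ⟨ν, S, hν, hsum, hS, hcard⟩ := exists_two_level (L := L) (U := U) (r := 1 / n)
      (k := n - 2) hn le_rfl hLn hnU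
      (by rw [Nat.cast_sub (by omega)]; push_cast; field_simp; linarith)
      (by rw [Nat.cast_sub (by omega)]; push_cast; field_simp; linarith)
    refine ⟨ν, S, 1 / n, 1, hν, hsum, hS, by positivity, ?_, one_pos, le_rfl, by omega, ?_, ?_⟩
    · exact one_div_le_one_div_of_le (by norm_num) (by linarith)
    · rw [hcard, Nat.cast_sub (by omega)]; push_cast; linarith
    · rw [one_div_one_div]; linarith
  · have hφ0 : 0 < φ := by
      by_contra! hc
      have : 1 / L * φ ≤ 0 := mul_nonpos_of_nonneg_of_nonpos (by positivity) hc
      linarith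
    have hU2 : 2 < 1 / U := by rw [lt_div_iff₀ hU0]; linarith
    obtain ⟨k, hk⟩ : ∃ k : ℕ, k = max 1 ⌊n * φ⌋₊ := ⟨_, rfl⟩
    have hfl := Nat.floor_le (show 0 ≤ n * φ by positivity)
    have hk1 : 1 ≤ k := by rw [hk]; exact le_max_left _ _
    have hkn : k ≤ n - 2 := by
      rw [hk]
      refine max_le (by omega) ?_
      have h1 : (⌊n * φ⌋₊ : ℝ) < (n - 2 : ℕ) := by
        rw [Nat.cast_sub (by omega)]; push_cast; linarith
      exact_mod_cast h1.le
    have hkU : 1 - k * L ≤ (n - k) * U := by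
      rcases le_or_gt ⌊n * φ⌋₊ 1 with h | h
      · rw [hk, max_eq_left h]; push_cast; linarith
      · rw [hk, max_eq_right h.le]
        have h1 : (⌊n * φ⌋₊ : ℝ) ≤ n - 1 / U := by rw [← hnφ]; exact hfl
        have h2 := mul_le_mul_of_nonneg_right (show 1 / U ≤ n - (⌊n * φ⌋₊ : ℝ) by linarith) hU0.le
        rw [one_div_mul_cancel hU0.ne'] at h2
        have h4 : 0 ≤ (⌊n * φ⌋₊ : ℝ) * L := by positivity
        linarith
    obtain ⟨ν, S, hν, hsum, hS, hcard⟩ := exists_two_level (L := L) (U := U) (r := L)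
      (k := k) hn hkn le_rfl (by linarith) hkU (by linarith)
    refine ⟨ν, S, L, φ, hν, hsum, hS, hL, ?_, hφ0, hφ1, by omega, ?_, ?_⟩
    · have : (1 : ℝ) / n ≤ 1 / 2 := one_div_le_one_div_of_le (by norm_num) (by linarith)
      linarith
    · rw [hcard, hk]
      push_cast
      rcases le_or_gt (n * φ) 2 with h | h
      · exact le_trans (by linarith) (le_max_left _ _)
      · exact le_trans (by linarith [Nat.lt_floor_add_one (n * φ)]) (le_max_right _ _)
    · rw [one_div_mul_eq_div] at hcase ⊢; linarith

/-- The three obstacles to fast convergence, at unit cost. -/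
lemma expect_failure_slowProfile_ge (hn : 3 ≤ n) (hα : 0 < α) (hα' : α < 1 / 4) (hg : 0 < g)
    (hgα : g ≤ α) {p : List (Fin n) → Fin n → ℝ} (hp : IsMoverLaw p) {S : Finset (Fin n)}
    {r φ : ℝ} (hr0 : 0 < r) (hr1 : r ≤ 1 / 2) (hφ0 : 0 < φ) (hφ1 : φ ≤ 1)
    (hS : ∀ i ∈ S, 2 ≤ i.val) (hpS : ∀ h, ∀ i ∈ S, p h i = r) (hcard : 1 ≤ S.card)
    (hcardn : n * φ / 3 ≤ S.card) {ε δ : ℝ} (hε : 0 < ε) (hε1 : ε < 1) (hδ : 0 < δ) {T : ℕ}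
    (hT : T < 1 / 80 * (2 * (φ / r) * max 0 (Real.log (n * δ))
            + Real.log (Real.log (1 / ε)) + Real.log (Real.log (1 / g)))) :
    1 - δ ≤ expect p T (failure α ε (slowProfile n g)) [] := by
  have hy : ∀ i, 0 ≤ slowProfile n g i := slowProfile_nonneg hg
  have hsum2 : ∑ i, slowProfile n g i ≤ 2 * g := by
    rw [sum_slowProfile hn]; split_ifs <;> linarith
  have h0 : ∑ i, slowProfile n g i ∈ Set.Ioo (0 : ℝ) 1 := by
    refine ⟨?_, by linarith⟩
    rw [sum_slowProfile hn]; split_ifs <;> linarith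
  set X := 2 * (φ / r) * max 0 (Real.log (n * δ)) with hX
  set E := Real.log (Real.log (1 / ε)) with hE
  set G := Real.log (Real.log (1 / g)) with hG
  have hT0 : (0 : ℝ) ≤ T := T.cast_nonneg
  rcases lt_or_ge (T : ℝ) (1 / 40 * X) with hcase | hcase
  · have hX0 : 0 < X := by linarith
    have hlog : 0 < Real.log (n * δ) := by
      by_contra! hc
      rw [hX, max_eq_left hc, mul_zero] at hX0
      exact lt_irrefl _ hX0
    rw [hX, max_eq_right hlog.le] at hcase
    have hnδ : 1 < n * δ := (Real.log_pos_iff (by positivity)).1 hlog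
    have h1 := expect_failure_ge hα hα' hy h0 hε1 hp (S := S) hr0.le (by linarith)
      (fun i hi => slowProfile_of_two_le (hS i hi)) hpS T []
    have h2 : S ∩ unmoved [] = S := by ext; simp [unmoved]
    rw [h2] at h1
    have h3 := coupon_pow_le (T := T) hr0 hr1 hφ0 hφ1 hcard hcardn hδ hnδ (by
      refine hcase.le.trans (le_of_eq ?_)
      field_simp
      norm_num)
    linarith
  -- the other two terms bound the number of moves whatever happens
  have hEG : T < 1 / 40 * (E + G) := by linarith
  rw [expect_failure_eq_one hp T []]
  · linarith
  intro h hh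
  rw [List.length_nil, zero_add] at hh
  have hhT : (h.length : ℝ) ≤ T := by exact_mod_cast hh
  rcases le_or_gt G E with hGE | hGE
  · exact not_isApproxEquilibrium_of_length_lt hn hα hα' hy h0 (slowProfile_far hn hg)
      (fun i => slowProfile_of_two_le) hε hε1 (by linarith)
  obtain _ | ⟨i, h⟩ := h
  · exact not_isApproxEquilibrium_of_eq_zero h0.1 h0.2 (i := ⟨2, by omega⟩)
      (slowProfile_of_two_le le_rfl) hε1
  have hlen : (1 : ℝ) ≤ (i :: h).length := by
    rw [List.length_cons]; push_cast; linarith [h.length.cast_nonneg (α := ℝ)]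
  have hg9 : g < 1 / 9 := by
    by_contra! hc
    have h1 : Real.log (1 / g) ≤ 1 / g - 1 := Real.log_le_sub_one_of_pos (by positivity)
    have h2 : 1 / g ≤ 9 := by
      rw [div_le_iff₀ hg]; linarith
    have h4 : 0 < Real.log (1 / g) := Real.log_pos (by rw [lt_div_iff₀ hg]; linarith)
    have h5 := Real.log_le_sub_one_of_pos h4
    linarith
  refine not_isApproxEquilibrium_of_small hn hα hα' hy h0 (fun k => ?_) hg (by linarith) hsum2 hε
    hε1 (by linarith) (by linarith)
  rw [sum_slowProfile hn, if_pos hg9]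
  unfold slowProfile
  split_ifs <;> linarith

end WorstCase

section LowerBound

variable {n : ℕ} {c a : ℝ}

/-- The selection rule that always draws the mover from the distribution `ν`. -/
def constantRule (ν : Fin n → ℝ) (h0 : ∀ i, 0 ≤ ν i) (h1 : ∑ i, ν i = 1) : SelectionRule n :=
  fun _ _ => PMF.ofFintype (fun i => ENNReal.ofReal (ν i)) (by
    rw [← ENNReal.ofReal_sum_of_nonneg fun i _ => h0 i, h1, ENNReal.ofReal_one])

lemma toReal_constantRule {ν : Fin n → ℝ} (h0 : ∀ i, 0 ≤ ν i) (h1 : ∑ i, ν i = 1) (t : ℕ)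
    (x : Fin n → ℝ) (i : Fin n) : (constantRule ν h0 h1 t x i).toReal = ν i := by
  rw [constantRule, PMF.ofFintype_apply, ENNReal.toReal_ofReal (h0 i)]

theorem exists_slow_dynamics (hn : 3 ≤ n) {L U g : ℝ} (hc : 0 < c) (ha : 0 < a)
    (hca : c * a < 1 / 4) (hL : 0 < L) (hLn : L ≤ 1 / n) (hnU : 1 / n ≤ U) (hU : U < 1 / 2)
    (hLU : 1 ≤ L + (n - 1) * U) (hg : 0 < g) (hga : g ≤ c * a) :
    ∃ (x₀ : Fin n → ℝ) (w : SelectionRule n),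
      (∀ i, 0 ≤ x₀ i) ∧ gamma c a x₀ = g ∧ IsAdmissible c a L U w x₀ ∧
      ∀ (ε δ : ℝ), 0 < ε → ε < 1 → 0 < δ → δ < 1 → ∀ T : ℕ,
        (T : ℝ) < 1 / 80 * ((n + 1 / L * (1 - 1 / (n * U))) * max 0 (Real.log (n * δ))
          + Real.log (Real.log (1 / ε)) + Real.log (Real.log (1 / g))) →
        1 - δ ≤ probNotReached c a ε w x₀ T := by
  obtain ⟨ν, S, r, φ, hν, hsum, hS, hr0, hr1, hφ0, hφ1, hcard, hcardn, hle⟩ :=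
    exists_slow_distribution hn hL hLn hnU hU hLU
  have hν0 : ∀ i, 0 ≤ ν i := fun i => hL.le.trans (hν i).1
  have hx : (fun i => c * (slowProfile n g i / c)) = slowProfile n g := by
    funext i; field_simp
  refine ⟨fun i => slowProfile n g i / c, constantRule ν hν0 hsum,
    fun i => div_nonneg (slowProfile_nonneg hg i) hc.le, ?_, ?_, ?_⟩
  · rw [← gamma_smul, hx]
    exact gamma_slowProfile hn hg hga hca
  · intro T h _ i
    rw [toReal_constantRule]
    exact ⟨(hν i).2, fun _ => (hν i).1⟩
  · intro ε δ hε hε1 hδ _ T hT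
    rw [probNotReached_eq hc, hx]
    refine expect_failure_slowProfile_ge hn (mul_pos hc ha) hca hg hga
      (isMoverLaw_moverProb _ _ _ _) hr0 hr1 hφ0 hφ1 (fun i hi => (hS i hi).1) ?_ hcard hcardn
      hε hε1 hδ (hT.trans_le ?_)
    · intro h i hi
      rw [moverProb, toReal_constantRule]
      exact (hS i hi).2
    · have := mul_le_mul_of_nonneg_right hle (le_max_left 0 (Real.log (n * δ)))
      linarith

end LowerBound

end LotteryContest

end

theorem mainTheorem2 :
    (∃ C : ℝ, 0 < C ∧
      ∀ (n : ℕ), 3 ≤ n →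
      ∀ (c a L U : ℝ), 0 < c → 0 < a → c * a < 1 / 4 → 0 < L → L ≤ U → U < 1 / 2 →
      ∀ (x₀ : Fin n → ℝ), (∀ i, 0 ≤ x₀ i) →
      ∀ (w : LotteryContest.SelectionRule n), LotteryContest.IsAdmissible c a L U w x₀ →
      ∀ (ε δ : ℝ), 0 < ε → ε < 1 → 0 < δ → δ < 1 →
      ∀ T : ℕ,
        C * (1 / (1 - 2 * U) * Real.log (Real.log (1 / LotteryContest.gamma c a x₀))
            + 1 / (L * (1 - 2 * U)) * Real.log (n / (ε * δ))
            + 1 / (1 - 2 * U) ^ 2 * Real.log (1 / δ)) ≤ (T : ℝ) →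
        1 - δ ≤ LotteryContest.probReached c a ε w x₀ T) ∧
    (∃ κ : ℝ, 0 < κ ∧
      ∀ (n : ℕ), 3 ≤ n →
      ∀ (c a L U : ℝ), 0 < c → 0 < a → c * a < 1 / 4 →
        0 < L → L ≤ 1 / n → 1 / n ≤ U → U < 1 / 2 → 1 ≤ L + (n - 1) * U →
      ∀ (g : ℝ), 0 < g → g ≤ c * a →
      ∃ (x₀ : Fin n → ℝ) (w : LotteryContest.SelectionRule n),
        (∀ i, 0 ≤ x₀ i) ∧ LotteryContest.gamma c a x₀ = g ∧
        LotteryContest.IsAdmissible c a L U w x₀ ∧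
        ∀ (ε δ : ℝ), 0 < ε → ε < 1 → 0 < δ → δ < 1 →
        ∀ T : ℕ,
          (T : ℝ) < κ * ((n + 1 / L * (1 - 1 / (n * U))) * max 0 (Real.log (n * δ))
            + Real.log (Real.log (1 / ε)) + Real.log (Real.log (1 / g))) →
          1 - δ ≤ LotteryContest.probNotReached c a ε w x₀ T) := by
  refine ⟨⟨200, by norm_num, ?_⟩, ⟨1 / 80, by norm_num, ?_⟩⟩
  · intro n hn c a L U hc ha hca hL hLU hU x₀ hx w hw ε δ hε hε1 hδ hδ1 T hT
    exact LotteryContest.probReached_ge hn hc ha hca hL hU hx hw hε hε1 hδ hδ1 hLU hT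
  · intro n hn c a L U hc ha hca hL hLn hnU hU hLU g hg hga
    exact LotteryContest.exists_slow_dynamics hn hc ha hca hL hLn hnU hU hLU hg hga
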